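/- Let $H$ be a separable complex Hilbert space. For a compact operator $A$ on $H$ let $s_1(A)\ge s_2(A)\ge\dots$ be its singular values (the eigenvalues of $(A^*A)^{1/2}$, counted with multiplicity). For $1\le p<\infty$ put $\|A\|_p=\bigl(\sum_k s_k(A)^p\bigr)^{1/p}$ and let $\mathcal S_p$ be the Schatten class of all compact operators $A$ with $\|A\|_p<\infty$. For $1\le r\le\infty$, $L^r(\mathbb R^n;\mathcal S_p)$ denotes the Bochner space of strongly measurable $\mathcal S_p$-valued functions with respect to Lebesgue measure. Theorem. Let $1\le p\le 2$, let $q$ be the conjugate exponent, that is, $q=p/(p-1)$ if $p\ne1$ and $q=\infty$ if $p=1$, and let $A\in L^1(\mathbb R^n;\mathcal S_p)\cap L^2(\mathbb R^n;\mathcal S_p)$, $\theta\mapsto A_\theta$. For $\xi\in\mathbb R^n$ the Bochner integral $$B_\xi=\int_{\mathbb R^n}A_\theta\,e^{-i\xi\cdot\theta}\,d\theta$$ is well defined and belongs to $\mathcal S_p$; moreover $B\in L^q(\mathbb R^n;\mathcal S_p)$ and, if $p>1$, $$\frac1{(2\pi)^n}\int_{\mathbb R^n}\Bigl\|\int_{\mathbb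 R^n}A_\theta\,e^{-i\xi\cdot\theta}\,d\theta\Bigr\|_p^q\,d\xi\le\Bigl(\int_{\mathbb R^n}\|A_\theta\|_p^p\,d\theta\Bigr)^{q/p},$$ while for $p=1$ $$\sup_{\xi\in\mathbb R^n}\Bigl\|\int_{\mathbb R^n}A_\theta\,e^{-i\xi\cdot\theta}\,d\theta\Bigr\|_1\le\int_{\mathbb R^n}\|A_\theta\|_1\,d\theta.$$ -/

import Mathlib

open MeasureTheory Filter
open scoped ENNReal Topology

noncomputable section

section Schatten

variable {H : Type*} [NormedAddCommGroup H] [InnerProductSpace ℂ H] [CompleteSpace H]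

/-- The multiplicity of `s > 0` as a singular value of `A`: the dimension of the eigenspace of
`A* A` for the eigenvalue `s ^ 2`. It is finite when `A` is compact, and it is `0` exactly when
`s` is not a singular value of `A`. -/
def singularMultiplicity (A : H →L[ℂ] H) (s : ℝ) : ℕ :=
  Module.finrank ℂ
    (Module.End.eigenspace ((ContinuousLinearMap.adjoint A ∘L A : H →L[ℂ] H) : H →ₗ[ℂ] H)
      ((s : ℂ) ^ 2))

open Classical in
/-- The Schatten norm `‖A‖_p = (∑ₙ sₙ(A) ^ p) ^ (1 / p)` of a compact operator, the sum running over
the nonzero singular values counted with multiplicity. The value is `∞` when the sum diverges, and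
also when `A` is not compact. -/
def schattenNorm (p : ℝ) (A : H →L[ℂ] H) : ℝ≥0∞ :=
  if IsCompactOperator A then
    (∑' s : Set.Ioi (0 : ℝ),
      (singularMultiplicity A (s : ℝ) : ℝ≥0∞) * ENNReal.ofReal (s : ℝ) ^ p) ^ (1 / p)
  else ∞

/-- Membership in the Schatten class `S_p`, for `1 ≤ p < ∞`. -/
def MemSchatten (p : ℝ) (A : H →L[ℂ] H) : Prop :=
  IsCompactOperator A ∧ schattenNorm p A < ∞

variable {Ω : Type*} [MeasurableSpace Ω]

/-- Strong (Bochner) measurability of `f` as a map into the normed space `S_p`: up to a null set,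
`f` is the pointwise limit, in the norm of `S_p`, of a sequence of `S_p`-valued simple functions. -/
def SchattenAEStronglyMeasurable (p : ℝ) (f : Ω → H →L[ℂ] H) (μ : Measure Ω) : Prop :=
  ∃ F : ℕ → SimpleFunc Ω (H →L[ℂ] H), (∀ k x, MemSchatten p (F k x)) ∧
    ∀ᵐ x ∂μ, Tendsto (fun k => schattenNorm p (F k x - f x)) atTop (𝓝 0)

/-- Membership of `f` in the Bochner space `L^r(μ; S_p)`, for `1 ≤ r ≤ ∞`. -/
def MemSchattenLp (p : ℝ) (r : ℝ≥0∞) (f : Ω → H →L[ℂ] H) (μ : Measure Ω) : Prop :=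
  (∀ᵐ x ∂μ, MemSchatten p (f x)) ∧ SchattenAEStronglyMeasurable p f μ ∧
    eLpNorm (fun x => schattenNorm p (f x)) r μ < ∞

/-- The integrand `e^{-i ξ · θ} A_θ` of the Fourier transform at the frequency `ξ`. -/
def fourierIntegrand {n : ℕ} (A : EuclideanSpace ℝ (Fin n) → H →L[ℂ] H)
    (ξ θ : EuclideanSpace ℝ (Fin n)) : H →L[ℂ] H :=
  Complex.exp (-(Complex.I * ((inner ℝ ξ θ : ℝ) : ℂ))) • A θ

/-- The Fourier transform `B_ξ = ∫ A_θ e^{-i ξ · θ} dθ`, a Bochner integral in `B(H)` with respect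
to Lebesgue measure. -/
def operatorFourier {n : ℕ} (A : EuclideanSpace ℝ (Fin n) → H →L[ℂ] H)
    (ξ : EuclideanSpace ℝ (Fin n)) : H →L[ℂ] H :=
  ∫ θ, fourierIntegrand A ξ θ

end Schatten

end

/-! The inequality interpolates between two endpoints. For `p = 1` the triangle inequality for the
Bochner integral sends `L¹(S₁)` to `L^∞(S₁)`. For `p = 2` the class `S₂` is a Hilbert space, and
Plancherel's theorem gives an isometry of `L²(S₂)`. The values stay in `S_p` while the exponent of
the outer space moves from `p` to `q`.

The Schatten norm is first rewritten as a supremum over pairs of orthonormal families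
(`schattenNorm_eq_variationalNorm`). In this form the triangle inequality is Minkowski's, and lower
semicontinuity gives completeness, so `S_p` becomes a Banach space `SchattenClass` to which Bochner
integration applies.

The interpolation is carried out by hand on a finite bilinear form. A step function with values of
finite rank is paired, through its Fourier transform, with a step function of norming functionals.
Raising the singular values and the dual weights to complex powers yields an analytic function on a
strip: Bessel's inequality bounds it on one edge, Plancherel's theorem for Hilbert-Schmidt operators
on the other, and the three lines theorem gives the estimate between them
(`norm_sum_mul_le_of_interpolation`, `norm_sum_dual_fourierPairing_le`).

Duality turns this into a norm bound for the Fourier transform of such step functions. Density and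
Fatou's lemma extend it to all integrable functions in `L^p(S_p)`, and the substitution `ξ = 2πη`
produces the factor `(2π)⁻ⁿ`. -/

noncomputable section

open scoped InnerProductSpace FourierTransform

/-! ### The Schatten norm as a supremum over orthonormal families -/

section Variational

variable {H : Type*} [NormedAddCommGroup H] [InnerProductSpace ℂ H]

/-- The variational form of the Schatten norm: the supremum of `(∑ₖ |⟪fₖ, A eₖ⟫| ^ p) ^ (1 / p)` over
all pairs of finite orthonormal families of the same length. -/
def variationalNorm (p : ℝ) (A : H →L[ℂ] H) : ℝ≥0∞ :=
  ⨆ (N : ℕ) (e : Fin N → H) (f : Fin N → H) (_ : Orthonormal ℂ e) (_ : Orthonormal ℂ f),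
    (∑ k, ‖⟪f k, A (e k)⟫_ℂ‖ₑ ^ p) ^ (1 / p)

lemma variationalNorm_le_iff {p : ℝ} {A : H →L[ℂ] H} {C : ℝ≥0∞} :
    variationalNorm p A ≤ C ↔ ∀ (N : ℕ) (e f : Fin N → H), Orthonormal ℂ e → Orthonormal ℂ f →
      (∑ k, ‖⟪f k, A (e k)⟫_ℂ‖ₑ ^ p) ^ (1 / p) ≤ C := by
  simp only [variationalNorm, iSup_le_iff]

lemma sum_inner_rpow_le_variationalNorm {κ : Type*} [Fintype κ] (p : ℝ) (A : H →L[ℂ] H)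
    {e f : κ → H} (he : Orthonormal ℂ e) (hf : Orthonormal ℂ f) :
    (∑ k, ‖⟪f k, A (e k)⟫_ℂ‖ₑ ^ p) ^ (1 / p) ≤ variationalNorm p A := by
  let σ := Fintype.equivFin κ
  have h := variationalNorm_le_iff.1 (le_refl (variationalNorm p A)) _ (e ∘ σ.symm) (f ∘ σ.symm)
    (he.comp _ σ.symm.injective) (hf.comp _ σ.symm.injective)
  rwa [show (∑ k, ‖⟪f k, A (e k)⟫_ℂ‖ₑ ^ p)
    = ∑ k, ‖⟪(f ∘ σ.symm) k, A ((e ∘ σ.symm) k)⟫_ℂ‖ₑ ^ p from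
      (Equiv.sum_comp σ.symm (fun k => ‖⟪f k, A (e k)⟫_ℂ‖ₑ ^ p)).symm]

lemma Orthonormal.tsum_enorm_inner_sq_le {ι : Type*} {v : ι → H} (hv : Orthonormal ℂ v) (x : H) :
    ∑' i, ‖⟪v i, x⟫_ℂ‖ₑ ^ 2 ≤ ‖x‖ₑ ^ 2 := by
  refine ENNReal.summable.tsum_le_of_sum_le fun s => ?_
  have h := hv.sum_inner_products_le x (s := s)
  simp only [← ofReal_norm, ← ENNReal.ofReal_pow (norm_nonneg _)]
  rw [← ENNReal.ofReal_sum_of_nonneg (fun _ _ => by positivity)]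
  exact ENNReal.ofReal_le_ofReal h

/-- Jensen's inequality for weights of total mass at most one, deduced from the weighted Hölder
inequality on finite subsets. -/
lemma ENNReal.tsum_weight_mul_rpow_le {ι : Type*} {p : ℝ} (hp : 1 ≤ p) (w f : ι → ℝ≥0∞)
    (hw : ∑' i, w i ≤ 1) : (∑' i, w i * f i) ^ p ≤ ∑' i, w i * f i ^ p := by
  have hp0 : 0 < p := by linarith
  suffices h : ∑' i, w i * f i ≤ (∑' i, w i * f i ^ p) ^ p⁻¹ by
    calc _ ≤ ((∑' i, w i * f i ^ p) ^ p⁻¹) ^ p := by gcongr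
      _ = _ := by rw [ENNReal.rpow_inv_rpow hp0.ne']
  refine ENNReal.summable.tsum_le_of_sum_le fun s => ?_
  refine (ENNReal.inner_le_weight_mul_Lp_of_nonneg s hp w f).trans ?_
  calc _ ≤ (1 : ℝ≥0∞) ^ (1 - p⁻¹) * (∑' i, w i * f i ^ p) ^ p⁻¹ := by
        gcongr
        · have := inv_le_one_of_one_le₀ hp
          linarith
        · exact (ENNReal.sum_le_tsum s).trans hw
        · exact ENNReal.sum_le_tsum s
    _ = _ := by simp

/-- An operator with a singular value decomposition `A = ∑ⱼ sⱼ ⟪uⱼ, ·⟫ vⱼ` has variational norm at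
most `(∑ⱼ |sⱼ| ^ p) ^ (1 / p)`. -/
lemma variationalNorm_le_of_hasSum {p : ℝ} (hp : 1 ≤ p) {A : H →L[ℂ] H} {J : Type*} {s : J → ℝ}
    {u v : J → H} (hu : Orthonormal ℂ u) (hv : Orthonormal ℂ v)
    (hA : ∀ x y, HasSum (fun j => (s j : ℂ) * ⟪u j, x⟫_ℂ * ⟪y, v j⟫_ℂ) ⟪y, A x⟫_ℂ) :
    variationalNorm p A ≤ (∑' j, ‖s j‖ₑ ^ p) ^ (1 / p) := by
  have hp0 : 0 < p := by linarith
  refine variationalNorm_le_iff.2 fun N e f he hf => ?_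
  gcongr
  -- The matrix `d` is doubly substochastic by Bessel's inequality. By the inequality of the means
  -- it dominates `|⟪uⱼ, eₖ⟫ ⟪fₖ, vⱼ⟫|`, so Jensen's inequality in each row and summation over the
  -- columns give the bound.
  let d : Fin N → J → ℝ≥0∞ := fun k j => (‖⟪u j, e k⟫_ℂ‖ₑ ^ 2 + ‖⟪v j, f k⟫_ℂ‖ₑ ^ 2) / 2
  have hd1 : ∀ k, ∑' j, d k j ≤ 1 := fun k => by
    simp only [d, div_eq_mul_inv]
    rw [ENNReal.tsum_mul_right, ENNReal.tsum_add]
    have h1 := hu.tsum_enorm_inner_sq_le (e k)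
    have h2 := hv.tsum_enorm_inner_sq_le (f k)
    rw [← ofReal_norm, he.1 k] at h1
    rw [← ofReal_norm, hf.1 k] at h2
    simp only [ENNReal.ofReal_one, one_pow] at h1 h2
    calc _ ≤ (1 + 1) * (2 : ℝ≥0∞)⁻¹ := by gcongr
      _ = 1 := by rw [one_add_one_eq_two, ENNReal.mul_inv_cancel (by simp) (by simp)]
  have hd2 : ∀ j, ∑ k, d k j ≤ 1 := fun j => by
    simp only [d, div_eq_mul_inv]
    rw [← Finset.sum_mul, Finset.sum_add_distrib]
    have h1 := he.tsum_enorm_inner_sq_le (u j)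
    have h2 := hf.tsum_enorm_inner_sq_le (v j)
    rw [tsum_fintype, ← ofReal_norm, hu.1 j] at h1
    rw [tsum_fintype, ← ofReal_norm, hv.1 j] at h2
    simp only [ENNReal.ofReal_one, one_pow] at h1 h2
    calc _ ≤ (1 + 1) * (2 : ℝ≥0∞)⁻¹ := by
          gcongr
          · exact (Finset.sum_congr rfl fun k _ => by
              rw [← ofReal_norm, norm_inner_symm, ofReal_norm]).trans_le h1
          · exact (Finset.sum_congr rfl fun k _ => by
              rw [← ofReal_norm, norm_inner_symm, ofReal_norm]).trans_le h2
      _ = 1 := by rw [one_add_one_eq_two, ENNReal.mul_inv_cancel (by simp) (by simp)]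
  have hAk : ∀ k, ‖⟪f k, A (e k)⟫_ℂ‖ₑ ^ p ≤ ∑' j, d k j * ‖s j‖ₑ ^ p := fun k => by
    refine le_trans ?_ (ENNReal.tsum_weight_mul_rpow_le hp (d k) (fun j => ‖s j‖ₑ) (hd1 k))
    gcongr
    rw [← (hA (e k) (f k)).tsum_eq]
    refine enorm_tsum_le_tsum_enorm.trans (ENNReal.tsum_le_tsum fun j => ?_)
    simp only [d]
    rw [mul_assoc, enorm_mul, mul_comm,
      show ‖((s j : ℝ) : ℂ)‖ₑ = ‖s j‖ₑ by simp [← ofReal_norm]]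
    gcongr
    simp only [← ofReal_norm, ← ENNReal.ofReal_pow (norm_nonneg _)]
    rw [← ENNReal.ofReal_add (by positivity) (by positivity),
      show (2 : ℝ≥0∞) = ENNReal.ofReal 2 by simp, ← ENNReal.ofReal_div_of_pos (by norm_num)]
    apply ENNReal.ofReal_le_ofReal
    rw [norm_mul, norm_inner_symm (f k)]
    nlinarith [sq_nonneg (‖⟪u j, e k⟫_ℂ‖ - ‖⟪v j, f k⟫_ℂ‖)]
  calc _ ≤ ∑ k, ∑' j, d k j * ‖s j‖ₑ ^ p := Finset.sum_le_sum fun k _ => hAk k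
    _ = ∑' j, (∑ k, d k j) * ‖s j‖ₑ ^ p := by
        rw [← Summable.tsum_finsetSum (fun _ _ => ENNReal.summable)]
        exact tsum_congr fun j => (Finset.sum_mul ..).symm
    _ ≤ ∑' j, 1 * ‖s j‖ₑ ^ p := ENNReal.tsum_le_tsum fun j => by gcongr; exact hd2 j
    _ = _ := by simp

/-- An operator that maps `uⱼ` to `sⱼ vⱼ` has variational norm at least
`(∑ⱼ |sⱼ| ^ p) ^ (1 / p)`. -/
lemma tsum_rpow_le_variationalNorm {p : ℝ} (hp : 0 < p) {A : H →L[ℂ] H} {J : Type*} {s : J → ℝ}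
    {u v : J → H} (hu : Orthonormal ℂ u) (hv : Orthonormal ℂ v)
    (hA : ∀ j, A (u j) = (s j : ℂ) • v j) :
    (∑' j, ‖s j‖ₑ ^ p) ^ (1 / p) ≤ variationalNorm p A := by
  suffices h : ∑' j, ‖s j‖ₑ ^ p ≤ variationalNorm p A ^ p by
    calc _ ≤ (variationalNorm p A ^ p) ^ (1 / p) := by gcongr
      _ = _ := by rw [one_div, ENNReal.rpow_rpow_inv hp.ne']
  refine ENNReal.summable.tsum_le_of_sum_le fun F => ?_
  have h := sum_inner_rpow_le_variationalNorm p A (hu.comp ((↑) : F → J) Subtype.coe_injective)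
    (hv.comp ((↑) : F → J) Subtype.coe_injective)
  have h2 : ∀ k : F, ‖⟪(v ∘ (↑)) k, A ((u ∘ (↑)) k)⟫_ℂ‖ₑ ^ p = ‖s k‖ₑ ^ p := fun k => by
    simp only [Function.comp, hA, inner_smul_right]
    rw [inner_self_eq_norm_sq_to_K, hv.1]
    simp [← ofReal_norm]
  rw [Finset.sum_congr rfl fun k _ => h2 k, Finset.sum_coe_sort F (fun j => ‖s j‖ₑ ^ p)] at h
  calc _ = ((∑ j ∈ F, ‖s j‖ₑ ^ p) ^ (1 / p)) ^ p := by
        rw [one_div, ENNReal.rpow_inv_rpow hp.ne']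
    _ ≤ _ := by gcongr

lemma hasSum_inner_of_hasSum {A : H →L[ℂ] H} {J : Type*} {s : J → ℝ} {u v : J → H} {x : H}
    (h : HasSum (fun j => ((s j : ℂ) * ⟪u j, x⟫_ℂ) • v j) (A x)) (y : H) :
    HasSum (fun j => (s j : ℂ) * ⟪u j, x⟫_ℂ * ⟪y, v j⟫_ℂ) ⟪y, A x⟫_ℂ := by
  simpa [inner_smul_right] using h.mapL (innerSL ℂ y)

end Variational

/-! ### Singular values of compact operators -/

section SingularValueDecomposition

variable {H : Type*} [NormedAddCommGroup H] [InnerProductSpace ℂ H] [CompleteSpace H]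

/-- The singular value decomposition of a compact operator. -/
lemma exists_singularValueDecomposition {A : H →L[ℂ] H} (hA : IsCompactOperator A) :
    ∃ (J : Type) (s : J → ℝ) (u v : J → H), (∀ j, 0 < s j) ∧ Orthonormal ℂ u ∧ Orthonormal ℂ v ∧
      (∀ j, A (u j) = (s j : ℂ) • v j) ∧
      (∀ x, HasSum (fun j => ((s j : ℂ) * ⟪u j, x⟫_ℂ) • v j) (A x)) ∧
      ∀ p : ℝ, schattenNorm p A = (∑' j, ‖s j‖ₑ ^ p) ^ (1 / p) := by
  set T : H →L[ℂ] H := ContinuousLinearMap.adjoint A ∘L A with hT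
  have hTc : IsCompactOperator T := hA.clm_comp (ContinuousLinearMap.adjoint A)
  have hTs : (T : H →ₗ[ℂ] H).IsSymmetric := fun x y => by
    simp [hT, ContinuousLinearMap.adjoint_inner_left, ContinuousLinearMap.adjoint_inner_right]
  let V : Set.Ioi (0 : ℝ) → Submodule ℂ H := fun s =>
    Module.End.eigenspace (T : H →ₗ[ℂ] H) (((s : ℝ) : ℂ) ^ 2)
  have hfd : ∀ s, FiniteDimensional ℂ (V s) := fun s =>
    ContinuousLinearMap.finite_dimensional_eigenspace hTc _
      (pow_ne_zero 2 (Complex.ofReal_ne_zero.2 (ne_of_gt s.2)))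
  have hinj : Function.Injective (fun s : Set.Ioi (0 : ℝ) => (((s : ℝ) : ℂ) ^ 2)) := by
    intro s t hst
    have hst' : ((s : ℝ) : ℂ) ^ 2 = ((t : ℝ) : ℂ) ^ 2 := hst
    have h : (s : ℝ) ^ 2 = (t : ℝ) ^ 2 := by exact_mod_cast hst'
    exact Subtype.ext ((sq_eq_sq₀ (le_of_lt s.2) (le_of_lt t.2)).1 h)
  have hV : OrthogonalFamily ℂ (fun s => V s) fun s => (V s).subtypeₗᵢ :=
    hTs.orthogonalFamily_eigenspaces.comp hinj
  let b : ∀ s, OrthonormalBasis (Fin (Module.finrank ℂ (V s))) ℂ (V s) := fun s =>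
    stdOrthonormalBasis ℂ (V s)
  let J := Σ s : Set.Ioi (0 : ℝ), Fin (Module.finrank ℂ (V s))
  let s : J → ℝ := fun j => j.1
  let u : J → H := fun j => (b j.1 j.2 : H)
  let v : J → H := fun j => ((s j : ℂ)⁻¹) • A (u j)
  have hs : ∀ j, 0 < s j := fun j => j.1.2
  have hs' : ∀ j, (s j : ℂ) ≠ 0 := fun j => Complex.ofReal_ne_zero.2 (hs j).ne'
  have hu : Orthonormal ℂ u :=
    hV.orthonormal_sigma_orthonormal (v_family := fun s => b s) fun s => (b s).orthonormal
  have hTu : ∀ j, T (u j) = ((s j : ℂ) ^ 2) • u j := fun j =>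
    Module.End.mem_eigenspace_iff.1 (b j.1 j.2).2
  have hAu : ∀ j, A (u j) = (s j : ℂ) • v j := fun j => by
    simp [v, smul_smul, mul_inv_cancel₀ (hs' j)]
  have hin : ∀ x y, ⟪A x, A y⟫_ℂ = ⟪x, T y⟫_ℂ := fun x y => by
    simp [hT, ContinuousLinearMap.adjoint_inner_right]
  have hv : Orthonormal ℂ v := by
    classical
    rw [orthonormal_iff_ite] at hu ⊢
    intro i j
    simp only [v, inner_smul_left, inner_smul_right, hin, hTu, hu]
    split_ifs with h
    · subst h
      have := hs' i
      simp
      field_simp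
    · simp
  -- A vector orthogonal to all `uⱼ` is split along the kernel of `A`. The part orthogonal to the
  -- kernel is orthogonal to every eigenspace of `A* A`, hence zero by the spectral theorem.
  have hker : ∀ x, (∀ j, ⟪u j, x⟫_ℂ = 0) → A x = 0 := by
    intro x hx
    let E₀ := Module.End.eigenspace (T : H →ₗ[ℂ] H) 0
    have hE₀ : ∀ y, y ∈ E₀ ↔ A y = 0 := fun y => by
      rw [Module.End.mem_eigenspace_iff, zero_smul]
      constructor
      · intro h
        have h2 := hin y y
        rw [show T y = 0 from h, inner_zero_right] at h2
        exact inner_self_eq_zero.1 h2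
      · intro h; simp [hT, h]
    have hE₀c : IsClosed (E₀ : Set H) := by
      have : (E₀ : Set H) = A ⁻¹' {0} := by ext y; simpa using hE₀ y
      rw [this]
      exact isClosed_singleton.preimage A.continuous
    have : CompleteSpace E₀ := hE₀c.completeSpace_coe
    obtain ⟨y, hy, z, hz, rfl⟩ := E₀.exists_add_mem_mem_orthogonal x
    have hyu : ∀ j, ⟪u j, y⟫_ℂ = 0 := fun j => by
      have h := hTs (u j) y
      simp only [ContinuousLinearMap.coe_coe, hTu] at h
      have hTy : T y = 0 := by simp [hT, (hE₀ y).1 hy]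
      rw [hTy, inner_zero_right, inner_smul_left] at h
      have := hs' j
      simpa [this] using h
    have hzu : ∀ j, ⟪u j, z⟫_ℂ = 0 := fun j => by
      have := hx j
      rwa [inner_add_right, hyu, zero_add] at this
    have hz0 : z ∈ (⨆ μ, Module.End.eigenspace (T : Module.End ℂ H) μ)ᗮ := by
      rw [← Submodule.iInf_orthogonal, Submodule.mem_iInf]
      intro μ
      by_cases hμ : μ = 0
      · rw [hμ]; exact hz
      rw [Submodule.mem_orthogonal]
      intro w hw
      by_cases hw0 : w = 0
      · simp [hw0]
      have hTw : T w = μ • w := Module.End.mem_eigenspace_iff.1 hw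
      -- An eigenvalue of `A* A` is the square of `‖A w‖ / ‖w‖`, so a nonzero one is among the `s ^
      -- 2` with `s > 0` that index the family `u`.
      have hμ' : ((‖A w‖ / ‖w‖ : ℝ) : ℂ) ^ 2 = μ := by
        have h := hin w w
        rw [hTw, inner_smul_right, inner_self_eq_norm_sq_to_K, inner_self_eq_norm_sq_to_K] at h
        have : (‖w‖ : ℂ) ≠ 0 := by simpa using hw0
        push_cast
        rw [div_pow, div_eq_iff (pow_ne_zero 2 this)]
        exact h
      have hpos : 0 < ‖A w‖ / ‖w‖ := by
        refine lt_of_le_of_ne (by positivity) fun h => hμ ?_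
        rw [← hμ', ← h]; simp
      let r : Set.Ioi (0 : ℝ) := ⟨‖A w‖ / ‖w‖, hpos⟩
      have hwV : w ∈ V r := by
        simp only [V, r, hμ']; exact hw
      have := (b r).sum_repr ⟨w, hwV⟩
      have hw2 : w = ∑ i, (b r).repr ⟨w, hwV⟩ i • u ⟨r, i⟩ := by
        have h := congrArg (Subtype.val) this
        simpa [u] using h.symm
      rw [hw2, sum_inner]
      exact Finset.sum_eq_zero fun i _ => by rw [inner_smul_left, hzu, mul_zero]
    rw [ContinuousLinearMap.orthogonalComplement_iSup_eigenspaces_eq_bot hTc hTs,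
      Submodule.mem_bot] at hz0
    rw [hz0, add_zero]
    exact (hE₀ y).1 hy
  refine ⟨J, s, u, v, hs, hu, hv, hAu, fun x => ?_, fun p => ?_⟩
  -- The family `u` is completed to a Hilbert basis. The added vectors lie in the kernel of `A`, so
  -- only the `uⱼ` contribute to the expansion of `A x`.
  · obtain ⟨w, β, hw, hβ⟩ := hu.toSubtypeRange.exists_hilbertBasis_extension
    have h1 : HasSum (fun i => ⟪β i, x⟫_ℂ • A (β i)) (A x) := by
      have h := (β.hasSum_repr x).mapL A
      simpa [β.repr_apply_apply] using h
    let ι : J → w := fun j => ⟨u j, hw ⟨j, rfl⟩⟩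
    have hι : Function.Injective ι := fun i j h =>
      hu.linearIndependent.injective (congrArg Subtype.val h)
    have h2 := (hι.hasSum_iff (f := fun i => ⟪β i, x⟫_ℂ • A (β i)) (a := A x) ?_).2 h1
    · refine h2.congr_fun ?_
      intro j
      simp only [Function.comp, hβ, ι, hAu, smul_smul, mul_comm]
    · intro i hi
      have : A (β i) = 0 := hker _ fun j => by
        have hne : ι j ≠ i := fun h => hi ⟨j, h⟩
        have h := β.orthonormal.2 hne
        simpa [hβ, ι] using h
      simp [this]
  · rw [schattenNorm, if_pos hA]
    congr 1
    rw [ENNReal.tsum_sigma']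
    refine tsum_congr fun r => ?_
    rw [tsum_fintype]
    simp only [s, singularMultiplicity, Finset.sum_const, Finset.card_univ, Fintype.card_fin,
      nsmul_eq_mul, V]
    congr 2
    rw [← ofReal_norm, Real.norm_of_nonneg (le_of_lt r.2)]

/-- The singular vectors themselves attain the supremum in the limit of finite subfamilies, and the
doubly substochastic estimate shows that no other families do better. -/
theorem schattenNorm_eq_variationalNorm {p : ℝ} (hp : 1 ≤ p) {A : H →L[ℂ] H}
    (hA : IsCompactOperator A) : schattenNorm p A = variationalNorm p A := by
  obtain ⟨J, s, u, v, -, hu, hv, hAu, hsum, hn⟩ := exists_singularValueDecomposition hA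
  rw [hn p]
  exact le_antisymm (tsum_rpow_le_variationalNorm (by linarith) hu hv hAu)
    (variationalNorm_le_of_hasSum hp hu hv fun x y => hasSum_inner_of_hasSum (hsum x) y)

end SingularValueDecomposition

/-! ### Norm properties and lower semicontinuity -/

section VariationalNorm

variable {H : Type*} [NormedAddCommGroup H] [InnerProductSpace ℂ H]

lemma variationalNorm_add_le {p : ℝ} (hp : 1 ≤ p) (A B : H →L[ℂ] H) :
    variationalNorm p (A + B) ≤ variationalNorm p A + variationalNorm p B := by
  refine variationalNorm_le_iff.2 fun N e f he hf => ?_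
  calc _ ≤ (∑ k, (‖⟪f k, A (e k)⟫_ℂ‖ₑ + ‖⟪f k, B (e k)⟫_ℂ‖ₑ) ^ p) ^ (1 / p) := by
        have : 0 ≤ p := by linarith
        gcongr with k
        rw [add_apply, inner_add_right]
        exact enorm_add_le _ _
    _ ≤ _ := ENNReal.Lp_add_le _ _ _ hp
    _ ≤ _ := add_le_add (sum_inner_rpow_le_variationalNorm p A he hf)
        (sum_inner_rpow_le_variationalNorm p B he hf)

lemma variationalNorm_smul_le {p : ℝ} (hp : 0 < p) (c : ℂ) (A : H →L[ℂ] H) :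
    variationalNorm p (c • A) ≤ ‖c‖ₑ * variationalNorm p A := by
  refine variationalNorm_le_iff.2 fun N e f he hf => ?_
  calc _ = ‖c‖ₑ * (∑ k, ‖⟪f k, A (e k)⟫_ℂ‖ₑ ^ p) ^ (1 / p) := by
        simp only [smul_apply, inner_smul_right, enorm_mul,
          ENNReal.mul_rpow_of_nonneg _ _ hp.le, ← Finset.mul_sum]
        rw [ENNReal.mul_rpow_of_nonneg _ _ (by positivity), one_div, ENNReal.rpow_rpow_inv hp.ne']
    _ ≤ _ := by gcongr; exact sum_inner_rpow_le_variationalNorm p A he hf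

lemma variationalNorm_zero {p : ℝ} (hp : 0 < p) : variationalNorm p (0 : H →L[ℂ] H) = 0 := by
  refine le_antisymm (variationalNorm_le_iff.2 fun N e f he hf => ?_) zero_le
  simp [hp]

/-- One-element families suffice: test with a unit vector `x` and the normalisation of `A x`. -/
lemma enorm_le_variationalNorm {p : ℝ} (hp : 0 < p) (A : H →L[ℂ] H) :
    ‖A‖ₑ ≤ variationalNorm p A := by
  by_cases htop : variationalNorm p A = ∞
  · simp [htop]
  have key : ∀ x : H, ‖x‖ = 1 → ‖A x‖ₑ ≤ variationalNorm p A := fun x hx => by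
    by_cases h0 : A x = 0
    · simp [h0]
    have he : Orthonormal ℂ (fun _ : Fin 1 => x) := by
      refine ⟨fun _ => hx, fun i j hij => absurd (Subsingleton.elim i j) hij⟩
    have hn : (‖A x‖ : ℂ) ≠ 0 := by simpa using h0
    have hf : Orthonormal ℂ (fun _ : Fin 1 => ((‖A x‖ : ℂ)⁻¹) • A x) := by
      refine ⟨fun _ => ?_, fun i j hij => absurd (Subsingleton.elim i j) hij⟩
      rw [norm_smul, norm_inv, Complex.norm_real, norm_norm, inv_mul_cancel₀ (by simpa using h0)]
    have h := sum_inner_rpow_le_variationalNorm p A he hf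
    simp only [Finset.univ_unique, Finset.sum_singleton, one_div,
      ENNReal.rpow_rpow_inv hp.ne', inner_smul_left, inner_self_eq_norm_sq_to_K] at h
    refine le_trans (le_of_eq ?_) h
    have : (starRingEnd ℂ) (‖A x‖ : ℂ)⁻¹ * ((‖A x‖ : ℂ)) ^ 2 = (‖A x‖ : ℂ) := by
      rw [map_inv₀, Complex.conj_ofReal]; field_simp
    erw [this]
    simp [← ofReal_norm]
  rw [← ofReal_norm]
  refine ENNReal.ofReal_le_of_le_toReal (A.opNorm_le_bound ENNReal.toReal_nonneg fun x => ?_)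
  by_cases hx : x = 0
  · simp [hx]
  have hx' : (‖x‖ : ℂ) ≠ 0 := by simpa using hx
  have h := key ((‖x‖ : ℂ)⁻¹ • x) (by
    rw [norm_smul, norm_inv, Complex.norm_real, norm_norm, inv_mul_cancel₀ (by simpa using hx)])
  rw [← ofReal_norm, ENNReal.ofReal_le_iff_le_toReal htop, map_smul, norm_smul, norm_inv,
    Complex.norm_real, norm_norm, inv_mul_le_iff₀ (by simpa using hx)] at h
  rwa [mul_comm]

/-- For fixed families the finite sum is continuous in the operator norm, and a supremum of
continuous functions is lower semicontinuous. -/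
lemma variationalNorm_le_of_tendsto {p : ℝ} {ι : Type*} {l : Filter ι} [l.NeBot]
    {T : ι → H →L[ℂ] H} {A : H →L[ℂ] H} (hT : Tendsto T l (𝓝 A)) {C : ℝ≥0∞}
    (hC : ∀ᶠ i in l, variationalNorm p (T i) ≤ C) : variationalNorm p A ≤ C := by
  refine variationalNorm_le_iff.2 fun N e f he hf => ?_
  have hlim : Tendsto (fun i => (∑ k, ‖⟪f k, T i (e k)⟫_ℂ‖ₑ ^ p) ^ (1 / p)) l
      (𝓝 ((∑ k, ‖⟪f k, A (e k)⟫_ℂ‖ₑ ^ p) ^ (1 / p))) := by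
    refine (ENNReal.continuous_rpow_const.tendsto _).comp ?_
    refine tendsto_finsetSum _ fun k _ => (ENNReal.continuous_rpow_const.tendsto _).comp ?_
    refine (continuous_enorm.tendsto _).comp ?_
    refine Tendsto.inner tendsto_const_nhds ?_
    exact ((ContinuousLinearMap.apply ℂ H (e k)).continuous.tendsto A).comp hT
  exact le_of_tendsto hlim (hC.mono fun i hi =>
    (sum_inner_rpow_le_variationalNorm p (T i) he hf).trans hi)

end VariationalNorm

/-! ### The Schatten class as a Banach space -/

section SchattenClass

variable {H : Type*} [NormedAddCommGroup H] [InnerProductSpace ℂ H]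

variable (p : ℝ) [hp : Fact (1 ≤ p)]

variable (H) in
/-- The Schatten class as a linear subspace of the bounded operators. -/
def schattenSubmodule : Submodule ℂ (H →L[ℂ] H) where
  carrier := {A | IsCompactOperator A ∧ variationalNorm p A < ∞}
  add_mem' := fun {A B} hA hB => ⟨hA.1.add hB.1,
    (variationalNorm_add_le hp.out A B).trans_lt (ENNReal.add_lt_top.2 ⟨hA.2, hB.2⟩)⟩
  zero_mem' := ⟨isCompactOperator_zero, by
    rw [variationalNorm_zero (zero_lt_one.trans_le hp.out)]; exact ENNReal.zero_lt_top⟩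
  smul_mem' := fun c A hA => ⟨hA.1.smul c,
    (variationalNorm_smul_le (zero_lt_one.trans_le hp.out) c A).trans_lt
      (ENNReal.mul_lt_top enorm_lt_top hA.2)⟩

lemma memSchatten_iff_mem_schattenSubmodule [CompleteSpace H] {A : H →L[ℂ] H} :
    MemSchatten p A ↔ A ∈ schattenSubmodule H p := by
  change _ ∧ _ ↔ _ ∧ _
  refine and_congr_right fun h => ?_
  rw [schattenNorm_eq_variationalNorm hp.out h]

variable (H) in
/-- The Schatten class as a type, to be equipped with the Schatten norm instead of the operator
norm. -/
def SchattenClass : Type _ := schattenSubmodule H p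

namespace SchattenClass

instance : AddCommGroup (SchattenClass H p) := inferInstanceAs (AddCommGroup (schattenSubmodule H p))

instance : Module ℂ (SchattenClass H p) := inferInstanceAs (Module ℂ (schattenSubmodule H p))

variable {p}

/-- The inclusion of the Schatten class into the bounded operators, as a linear map. -/
def inclₗ : SchattenClass H p →ₗ[ℂ] (H →L[ℂ] H) := (schattenSubmodule H p).subtype

lemma inclₗ_injective : Function.Injective (inclₗ : SchattenClass H p →ₗ[ℂ] (H →L[ℂ] H)) :=
  Subtype.coe_injective

lemma isCompactOperator (T : SchattenClass H p) : IsCompactOperator (inclₗ T) := T.2.1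

lemma variationalNorm_ne_top (T : SchattenClass H p) : variationalNorm p (inclₗ T) ≠ ∞ := T.2.2.ne

/-- The element of the Schatten class given by a compact operator with finite norm. -/
def mk (A : H →L[ℂ] H) (hA : IsCompactOperator A) (h : variationalNorm p A < ∞) :
    SchattenClass H p := ⟨A, hA, h⟩

@[simp] lemma inclₗ_mk (A : H →L[ℂ] H) (hA : IsCompactOperator A) (h : variationalNorm p A < ∞) :
    inclₗ (mk A hA h) = A := rfl

instance : NormedAddCommGroup (SchattenClass H p) :=
  AddGroupNorm.toNormedAddCommGroup
    { toFun := fun T => (variationalNorm p (inclₗ T)).toReal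
      map_zero' := by simp [variationalNorm_zero (zero_lt_one.trans_le hp.out)]
      add_le' := fun S T => by
        rw [← ENNReal.toReal_add S.variationalNorm_ne_top T.variationalNorm_ne_top, map_add]
        exact ENNReal.toReal_mono
          (ENNReal.add_ne_top.2 ⟨S.variationalNorm_ne_top, T.variationalNorm_ne_top⟩)
          (variationalNorm_add_le hp.out _ _)
      neg' := fun T => by
        have h : ∀ S : SchattenClass H p,
            variationalNorm p (inclₗ (-S)) ≤ variationalNorm p (inclₗ S) := fun S => by
          have := variationalNorm_smul_le (zero_lt_one.trans_le hp.out) (-1) (inclₗ S)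
          simpa using this
        congr 1
        refine le_antisymm (h T) ?_
        simpa using h (-T)
      eq_zero_of_map_eq_zero' := fun T hT => by
        rw [ENNReal.toReal_eq_zero_iff, or_iff_left T.variationalNorm_ne_top] at hT
        have h := enorm_le_variationalNorm (zero_lt_one.trans_le hp.out) (inclₗ T)
        rw [hT, nonpos_iff_eq_zero] at h
        exact inclₗ_injective (by simpa [← ofReal_norm] using h) }

lemma norm_def (T : SchattenClass H p) : ‖T‖ = (variationalNorm p (inclₗ T)).toReal := rfl

lemma enorm_eq (T : SchattenClass H p) : ‖T‖ₑ = variationalNorm p (inclₗ T) := by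
  rw [← ofReal_norm, norm_def, ENNReal.ofReal_toReal T.variationalNorm_ne_top]

lemma enorm_eq_schattenNorm [CompleteSpace H] (T : SchattenClass H p) : ‖T‖ₑ = schattenNorm p (inclₗ T) := by
  rw [enorm_eq, schattenNorm_eq_variationalNorm hp.out T.isCompactOperator]

instance : NormedSpace ℂ (SchattenClass H p) where
  norm_smul_le c T := by
    rw [norm_def, norm_def, ← toReal_enorm c, ← ENNReal.toReal_mul, map_smul]
    exact ENNReal.toReal_mono (ENNReal.mul_ne_top enorm_ne_top T.variationalNorm_ne_top)
      (variationalNorm_smul_le (zero_lt_one.trans_le hp.out) c _)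

/-- The inclusion of the Schatten class into the bounded operators, as a continuous linear map. -/
def incl : SchattenClass H p →L[ℂ] (H →L[ℂ] H) :=
  inclₗ.mkContinuous 1 fun T => by
    rw [one_mul, norm_def, ← toReal_enorm]
    exact ENNReal.toReal_mono T.variationalNorm_ne_top
      (enorm_le_variationalNorm (zero_lt_one.trans_le hp.out) _)

@[simp] lemma incl_apply (T : SchattenClass H p) : incl T = inclₗ T := rfl

/-- A Cauchy sequence converges in operator norm to a compact operator. Lower semicontinuity,
applied to the differences of its terms, upgrades this to convergence in the Schatten norm. -/
instance [CompleteSpace H] : CompleteSpace (SchattenClass H p) := by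
  have hp0 : 0 < p := zero_lt_one.trans_le hp.out
  refine Metric.complete_of_cauchySeq_tendsto fun T hT => ?_
  have hc : CauchySeq fun k => inclₗ (T k) := hT.map (incl (H := H) (p := p)).uniformContinuous
  obtain ⟨A, hA⟩ := cauchySeq_tendsto_of_complete hc
  have hAc : IsCompactOperator A :=
    isClosed_setOfPred_isCompactOperator.mem_of_tendsto hA (.of_forall fun k => (T k).isCompactOperator)
  have key : ∀ ε > 0, ∃ N, ∀ k ≥ N, variationalNorm p (inclₗ (T k) - A) ≤ ENNReal.ofReal ε := by
    intro ε hε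
    obtain ⟨N, hN⟩ := Metric.cauchySeq_iff.1 hT ε hε
    refine ⟨N, fun k hk => ?_⟩
    refine variationalNorm_le_of_tendsto (T := fun m => inclₗ (T k) - inclₗ (T m))
      (tendsto_const_nhds.sub hA) (eventually_atTop.2 ⟨N, fun m hm => ?_⟩)
    rw [← map_sub, ← enorm_eq, ← ofReal_norm, ← dist_eq_norm]
    exact ENNReal.ofReal_le_ofReal (hN k hk m hm).le
  have hAt : variationalNorm p A < ∞ := by
    obtain ⟨N, hN⟩ := key 1 one_pos
    have h := variationalNorm_add_le hp.out (inclₗ (T N)) ((-1 : ℂ) • (inclₗ (T N) - A))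
    rw [show inclₗ (T N) + (-1 : ℂ) • (inclₗ (T N) - A) = A by
      rw [neg_one_smul]; abel] at h
    refine h.trans_lt (ENNReal.add_lt_top.2 ⟨(T N).variationalNorm_ne_top.lt_top, ?_⟩)
    refine (variationalNorm_smul_le hp0 _ _).trans_lt (ENNReal.mul_lt_top enorm_lt_top ?_)
    exact (hN N le_rfl).trans_lt ENNReal.ofReal_lt_top
  refine ⟨mk A hAc hAt, Metric.tendsto_atTop.2 fun ε hε => ?_⟩
  obtain ⟨N, hN⟩ := key (ε / 2) (half_pos hε)
  refine ⟨N, fun k hk => ?_⟩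
  have h := hN k hk
  rw [dist_eq_norm, norm_def, map_sub, inclₗ_mk]
  exact (ENNReal.toReal_le_of_le_ofReal (half_pos hε).le h).trans_lt (half_lt_self hε)

end SchattenClass

end SchattenClass

/-! ### Plancherel's theorem for step functions with Hilbert space values -/

section Plancherel

variable {V : Type*} [NormedAddCommGroup V] [InnerProductSpace ℝ V] [FiniteDimensional ℝ V]
  [MeasurableSpace V] [BorelSpace V]

lemma continuous_fourier_of_integrable {X : Type*} [NormedAddCommGroup X] [NormedSpace ℂ X]
    {f : V → X} (hf : Integrable f) : Continuous (𝓕 f) :=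
  VectorFourier.fourierIntegral_continuous Real.continuous_fourierChar
    (innerSL ℝ).continuous₂ hf

lemma norm_fourier_le_integral_norm {X : Type*} [NormedAddCommGroup X] [NormedSpace ℂ X]
    (f : V → X) (ξ : V) : ‖𝓕 f ξ‖ ≤ ∫ v, ‖f v‖ :=
  VectorFourier.norm_fourierIntegral_le_integral_norm _ _ _ _ _

variable {F : Type*} [NormedAddCommGroup F] [InnerProductSpace ℂ F] [CompleteSpace F]

/-- The Fourier transform on `L²` is given by the Fourier integral for integrable functions. -/
lemma coeFn_fourier_toLp {f : V → F} (hf : Integrable f) (hf₂ : MemLp f 2) :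
    (𝓕 (hf₂.toLp f) : Lp F 2 (volume : Measure V)) =ᵐ[volume] 𝓕 f := by
  set g : Lp F 2 (volume : Measure V) := 𝓕 (hf₂.toLp f) with hg
  have hgl : LocallyIntegrable g (volume : Measure V) :=
    (Lp.memLp g).locallyIntegrable (by norm_num)
  have hfl : LocallyIntegrable (𝓕 f) (volume : Measure V) :=
    (continuous_fourier_of_integrable hf).locallyIntegrable
  -- Both functions are tested against smooth compactly supported `φ`. The transform on `L²` is
  -- moved onto `φ` by its compatibility with tempered distributions, and moved back by the
  -- multiplication formula for integrable functions.
  refine ae_eq_of_integral_contDiff_smul_eq hgl hfl fun φ hφ hφc => ?_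
  have h₁ : HasCompactSupport (Complex.ofRealCLM ∘ φ) := hφc.comp_left rfl
  have h₂ : ContDiff ℝ (⊤ : ℕ∞) (Complex.ofRealCLM ∘ φ) := by fun_prop
  let ψ : SchwartzMap V ℂ := h₁.toSchwartzMap h₂
  have hψ : ∀ x, ψ x = (φ x : ℂ) := fun x => rfl
  have e1 : ∫ x, ψ x • g x = ∫ x, (𝓕 ψ) x • (hf₂.toLp f : Lp F 2 (volume : Measure V)) x := by
    rw [← Lp.toTemperedDistribution_apply, ← Lp.toTemperedDistribution_apply, hg,
      ← Lp.fourier_toTemperedDistribution_eq, TemperedDistribution.fourier_apply]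
  have e2 : ∫ x, (𝓕 ψ) x • (hf₂.toLp f : Lp F 2 (volume : Measure V)) x
      = ∫ x, (𝓕 ψ) x • f x := by
    refine integral_congr_ae ?_
    filter_upwards [hf₂.coeFn_toLp] with x hx
    rw [hx]
  have e3 : ∫ x, (𝓕 ψ) x • f x = ∫ x, ψ x • 𝓕 f x := by
    have h := VectorFourier.integral_fourierIntegral_smul_eq_flip (L := innerₗ V)
      Real.continuous_fourierChar continuous_inner (ψ.integrable (μ := volume)) hf
    rw [flip_innerₗ] at h
    exact h
  have e4 := e1.trans (e2.trans e3)
  simpa only [hψ, Complex.coe_smul] using e4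

/-- The Fourier transform of the indicator function of a set. -/
def fourierIndicator (E : Set V) : V → ℂ := 𝓕 (E.indicator fun _ => (1 : ℂ))

lemma integrable_indicator_const {X : Type*} [NormedAddCommGroup X] {E : Set V}
    (hE : MeasurableSet E) (hE' : volume E ≠ ∞) (x : X) :
    Integrable (E.indicator fun _ => x) := by
  rw [integrable_indicator_iff hE]
  exact integrableOn_const hE'

lemma continuous_fourierIndicator {E : Set V} (hE : MeasurableSet E) (hE' : volume E ≠ ∞) :
    Continuous (fourierIndicator E) :=
  continuous_fourier_of_integrable (integrable_indicator_const hE hE' 1)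

lemma norm_fourierIndicator_le {E : Set V} (hE : MeasurableSet E) (ξ : V) :
    ‖fourierIndicator E ξ‖ ≤ volume.real E := by
  refine (norm_fourier_le_integral_norm _ ξ).trans (le_of_eq ?_)
  simp only [norm_indicator_eq_indicator_norm, norm_one]
  rw [integral_indicator hE]
  simp

lemma fourier_indicator_const {X : Type*} [NormedAddCommGroup X] [NormedSpace ℂ X]
    [CompleteSpace X] (E : Set V) (x : X) (ξ : V) :
    𝓕 (E.indicator fun _ => x) ξ = fourierIndicator E ξ • x := by
  rw [fourierIndicator, Real.fourier_eq, Real.fourier_eq, ← integral_smul_const]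
  congr 1
  ext v
  by_cases hv : v ∈ E <;> simp [hv, Circle.smul_def]

/-- The pairing `∫_F ∫_E e^{-2πi ⟪θ, ξ⟫} dθ dξ`. -/
def fourierPairing (E F : Set V) : ℂ := ∫ ξ in F, fourierIndicator E ξ

/-- The scalar `L¹`-`L^∞` bound, which supplies the first edge of the interpolation. -/
lemma norm_fourierPairing_le {E F : Set V} (hE : MeasurableSet E) (hF : volume F ≠ ∞) :
    ‖fourierPairing E F‖ ≤ volume.real E * volume.real F :=
  norm_setIntegral_le_of_norm_le_const hF.lt_top fun ξ _ => norm_fourierIndicator_le hE ξ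

lemma inner_indicatorConstLp_fourier {A B : Set V} (hA : MeasurableSet A) (hA' : volume A ≠ ∞)
    (hB : MeasurableSet B) (hB' : volume B ≠ ∞) (x y : F) :
    ⟪indicatorConstLp 2 hB hB' y, (𝓕 (indicatorConstLp 2 hA hA' x) : Lp F 2 (volume : Measure V))⟫_ℂ
      = ⟪y, x⟫_ℂ * fourierPairing A B := by
  rw [L2.inner_indicatorConstLp_eq_setIntegral_inner, fourierPairing, ← integral_const_mul]
  refine integral_congr_ae (ae_restrict_of_ae ?_)
  filter_upwards [coeFn_fourier_toLp (integrable_indicator_const hA hA' x)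
    (memLp_indicator_const 2 hA x (Or.inr hA'))] with ξ hξ
  change ⟪y, ((𝓕 ((memLp_indicator_const 2 hA x (Or.inr hA')).toLp _) :
    Lp F 2 (volume : Measure V)) : V → F) ξ⟫_ℂ = _
  rw [hξ, fourier_indicator_const, inner_smul_right, mul_comm]

lemma norm_sum_indicatorConstLp_sq {ι : Type*} [Fintype ι] {A : ι → Set V}
    (hA : ∀ i, MeasurableSet (A i)) (hA' : ∀ i, volume (A i) ≠ ∞)
    (hd : Pairwise (Function.onFun Disjoint A)) (x : ι → F) :
    ‖∑ i, indicatorConstLp 2 (hA i) (hA' i) (x i)‖ ^ 2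
      = ∑ i, volume.real (A i) * ‖x i‖ ^ 2 := by
  have h : ⟪∑ i, indicatorConstLp 2 (hA i) (hA' i) (x i),
      ∑ i, indicatorConstLp 2 (hA i) (hA' i) (x i)⟫_ℂ
      = ((∑ i, volume.real (A i) * ‖x i‖ ^ 2 : ℝ) : ℂ) := by
    rw [sum_inner]
    push_cast
    refine Finset.sum_congr rfl fun i _ => ?_
    rw [inner_sum, Finset.sum_eq_single i]
    · rw [L2.inner_indicatorConstLp_indicatorConstLp (hA i) (hA i) (hA' i) (hA' i), Set.inter_self, inner_self_eq_norm_sq_to_K]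
      simp
    · intro j _ hj
      rw [L2.inner_indicatorConstLp_indicatorConstLp (hA i) (hA j) (hA' i) (hA' j), (hd hj.symm).inter_eq]
      simp
    · simp
  rw [norm_sq_eq_re_inner (𝕜 := ℂ), h]
  exact Complex.ofReal_re _

/-- The `L²` bound for the Fourier transform between step functions with values in a Hilbert
space. -/
lemma norm_sum_inner_mul_fourierPairing_le {ι κ : Type*} [Fintype ι] [Fintype κ] {A : ι → Set V}
    {B : κ → Set V} (hA : ∀ i, MeasurableSet (A i)) (hA' : ∀ i, volume (A i) ≠ ∞)
    (hAd : Pairwise (Function.onFun Disjoint A)) (hB : ∀ l, MeasurableSet (B l))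
    (hB' : ∀ l, volume (B l) ≠ ∞) (hBd : Pairwise (Function.onFun Disjoint B))
    (x : ι → F) (y : κ → F) :
    ‖∑ i, ∑ l, ⟪y l, x i⟫_ℂ * fourierPairing (A i) (B l)‖
      ≤ √(∑ i, volume.real (A i) * ‖x i‖ ^ 2) * √(∑ l, volume.real (B l) * ‖y l‖ ^ 2) := by
  set X : Lp F 2 (volume : Measure V) := ∑ i, indicatorConstLp 2 (hA i) (hA' i) (x i) with hX
  set Y : Lp F 2 (volume : Measure V) := ∑ l, indicatorConstLp 2 (hB l) (hB' l) (y l) with hY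
  have h1 : ⟪Y, (𝓕 X : Lp F 2 (volume : Measure V))⟫_ℂ
      = ∑ i, ∑ l, ⟪y l, x i⟫_ℂ * fourierPairing (A i) (B l) := by
    have hFX : (𝓕 X : Lp F 2 (volume : Measure V))
        = ∑ i, (𝓕 (indicatorConstLp 2 (hA i) (hA' i) (x i)) : Lp F 2 (volume : Measure V)) :=
      map_sum (Lp.fourierTransformₗᵢ V F) _ _
    rw [hFX, inner_sum]
    refine Finset.sum_congr rfl fun i _ => ?_
    rw [hY, sum_inner]
    exact Finset.sum_congr rfl fun l _ => inner_indicatorConstLp_fourier ..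
  rw [← norm_sum_indicatorConstLp_sq hA hA' hAd x, ← norm_sum_indicatorConstLp_sq hB hB' hBd y,
    Real.sqrt_sq (norm_nonneg _), Real.sqrt_sq (norm_nonneg _), ← h1, mul_comm]
  refine (norm_inner_le_norm _ _).trans (le_of_eq ?_)
  rw [Lp.norm_fourier_eq]

end Plancherel

/-! ### Rank one operators as vectors of a Hilbert space -/

section HilbertSchmidt

/-- Every Hilbert space has an antiunitary map to another Hilbert space. -/
lemma exists_inner_conj (H : Type*) [NormedAddCommGroup H] [InnerProductSpace ℂ H]
    [CompleteSpace H] : ∃ (w : Set H) (c : H → lp (fun _ : w => ℂ) 2),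
      ∀ x y, ⟪c x, c y⟫_ℂ = ⟪y, x⟫_ℂ := by
  obtain ⟨w, b, -⟩ := exists_hilbertBasis ℂ H
  refine ⟨w, fun x => star (b.repr x), fun x y => ?_⟩
  rw [← b.repr.inner_map_map, lp.inner_eq_tsum, lp.inner_eq_tsum]
  refine tsum_congr fun i => ?_
  simp [lp.star_apply, mul_comm]

open scoped TensorProduct in
/-- Pairs of vectors of a Hilbert space embed into a Hilbert space as rank one operators, with the
Hilbert-Schmidt inner product. -/
lemma exists_rankOne_embedding (H : Type*) [NormedAddCommGroup H] [InnerProductSpace ℂ H]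
    [CompleteSpace H] : ∃ (w : Set H)
      (t : H → H → UniformSpace.Completion (H ⊗[ℂ] lp (fun _ : w => ℂ) 2)),
      ∀ v u f e, ⟪t f e, t v u⟫_ℂ = ⟪f, v⟫_ℂ * ⟪u, e⟫_ℂ := by
  obtain ⟨w, c, hc⟩ := exists_inner_conj H
  -- The operator `⟪u, ·⟫ v` is represented by `v ⊗ c u`; the antiunitary `c` accounts for the
  -- conjugate linear dependence on `u`. The completion is taken because the Fourier transform on
  -- `L²` is applied with complete values.
  refine ⟨w, fun v u => ((v ⊗ₜ[ℂ] c u : H ⊗[ℂ] lp (fun _ : w => ℂ) 2) :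
    UniformSpace.Completion (H ⊗[ℂ] lp (fun _ : w => ℂ) 2)), fun v u f e => ?_⟩
  rw [UniformSpace.Completion.inner_coe, TensorProduct.inner_tmul, hc]

end HilbertSchmidt

/-! ### The Hilbert-Schmidt endpoint -/

section HilbertSchmidtPairing

variable {V : Type*} [NormedAddCommGroup V] [InnerProductSpace ℝ V] [FiniteDimensional ℝ V]
  [MeasurableSpace V] [BorelSpace V]
  {H : Type*} [NormedAddCommGroup H] [InnerProductSpace ℂ H] [CompleteSpace H]

/-- The `L²` bound for the Fourier transform between step functions whose values are finite rank
operators, with the Hilbert-Schmidt norm. -/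
lemma norm_sum_sigma_mul_fourierPairing_le {ι κ : Type*} [Fintype ι] [Fintype κ]
    {J : ι → Type} {K : κ → Type} [∀ i, Fintype (J i)] [∀ l, Fintype (K l)] {A : ι → Set V}
    {B : κ → Set V} (hA : ∀ i, MeasurableSet (A i)) (hA' : ∀ i, volume (A i) ≠ ∞)
    (hAd : Pairwise (Function.onFun Disjoint A)) (hB : ∀ l, MeasurableSet (B l))
    (hB' : ∀ l, volume (B l) ≠ ∞) (hBd : Pairwise (Function.onFun Disjoint B))
    {u v : ∀ i, J i → H} (hu : ∀ i, Orthonormal ℂ (u i)) (hv : ∀ i, Orthonormal ℂ (v i))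
    {e f : ∀ l, K l → H} (he : ∀ l, Orthonormal ℂ (e l)) (hf : ∀ l, Orthonormal ℂ (f l))
    (x : (Σ i, J i) → ℂ) (y : (Σ l, K l) → ℂ) :
    ‖∑ a : Σ i, J i, ∑ b : Σ l, K l, x a * y b *
        (⟪f b.1 b.2, v a.1 a.2⟫_ℂ * ⟪u a.1 a.2, e b.1 b.2⟫_ℂ * fourierPairing (A a.1) (B b.1))‖
      ≤ √(∑ a : Σ i, J i, volume.real (A a.1) * ‖x a‖ ^ 2) *
        √(∑ b : Σ l, K l, volume.real (B b.1) * ‖y b‖ ^ 2) := by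
  obtain ⟨w, t, ht⟩ := exists_rankOne_embedding H
  have hto : ∀ {I : Type} [Fintype I] (g h : I → H), Orthonormal ℂ g → Orthonormal ℂ h →
      Orthonormal ℂ fun i => t (g i) (h i) := by
    classical
    intro I _ g h hg hh
    rw [orthonormal_iff_ite] at hg hh ⊢
    intro i j
    rw [ht, hg, hh]
    by_cases hij : i = j <;> simp [hij, eq_comm]
  have hnorm : ∀ {I : Type} [Fintype I] (g h : I → H), Orthonormal ℂ g → Orthonormal ℂ h →
      ∀ z : I → ℂ, ‖∑ i, z i • t (g i) (h i)‖ ^ 2 = ∑ i, ‖z i‖ ^ 2 := by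
    intro I _ g h hg hh z
    have h1 := (hto g h hg hh).inner_sum z z Finset.univ
    rw [inner_self_eq_norm_sq_to_K] at h1
    simp only [RCLike.conj_mul] at h1
    exact_mod_cast h1
  -- The coefficients `y` are conjugated because the inner product is conjugate linear in its first
  -- argument. Orthonormality of the rank one tensors makes each norm the `ℓ²` norm of its
  -- coefficients.
  have key := norm_sum_inner_mul_fourierPairing_le hA hA' hAd hB hB' hBd
    (fun i => ∑ j, x ⟨i, j⟩ • t (v i j) (u i j))
    (fun l => ∑ k, (starRingEnd ℂ) (y ⟨l, k⟩) • t (f l k) (e l k))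
  have hx := fun i => hnorm (v i) (u i) (hv i) (hu i) fun j => x ⟨i, j⟩
  have hy := fun l => hnorm (f l) (e l) (hf l) (he l) fun k => (starRingEnd ℂ) (y ⟨l, k⟩)
  simp only [hx, hy, RCLike.norm_conj] at key
  simp only [Fintype.sum_sigma]
  convert key using 2
  · refine Finset.sum_congr rfl fun i _ => ?_
    rw [Finset.sum_comm]
    refine Finset.sum_congr rfl fun l _ => ?_
    rw [sum_inner, Finset.sum_mul, Finset.sum_comm]
    refine Finset.sum_congr rfl fun k _ => ?_
    rw [inner_sum, Finset.sum_mul]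
    refine Finset.sum_congr rfl fun j _ => ?_
    rw [inner_smul_left, inner_smul_right, ht, Complex.conj_conj]
    ring
  · simp only [Finset.mul_sum]
  · simp only [Finset.mul_sum]

end HilbertSchmidtPairing

/-! ### Complex interpolation of bilinear forms -/

section Interpolation

/-- The complex power `s ^ w` of a nonnegative number, with the value `0` at `s = 0` also for
`w = 0`. -/
def cutPow (s : ℝ) (w : ℂ) : ℂ := if s = 0 then 0 else (s : ℂ) ^ w

lemma norm_cutPow_le {s : ℝ} (hs : 0 ≤ s) (w : ℂ) : ‖cutPow s w‖ ≤ s ^ w.re := by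
  unfold cutPow
  split_ifs with h
  · simpa using Real.rpow_nonneg hs _
  · rw [Complex.norm_cpow_eq_rpow_re_of_pos (lt_of_le_of_ne hs (Ne.symm h))]

lemma differentiable_cutPow (s : ℝ) : Differentiable ℂ (cutPow s) := by
  unfold cutPow
  split_ifs with h
  · exact differentiable_const _
  · exact fun w => (differentiableAt_id.const_cpow (Or.inl (by simpa using h)))

lemma cutPow_one (s : ℝ) : cutPow s 1 = s := by
  unfold cutPow
  split_ifs with h <;> simp [h]

lemma rpow_le_one_add_rpow {s x M : ℝ} (hs : 0 ≤ s) (hx : 0 ≤ x) (hxM : x ≤ M) :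
    s ^ x ≤ (1 + s) ^ M :=
  (Real.rpow_le_rpow hs (by linarith) hx).trans
    (Real.rpow_le_rpow_of_exponent_le (by linarith) hxM)

/-- Interpolation between an `ℓ¹`-`ℓ¹(ℓ^∞)` bound and an `ℓ²`-`ℓ²` bound for a bilinear form, by the
three lines theorem. -/
theorem norm_sum_mul_le_of_interpolation {α κ : Type*} [Fintype α] [Fintype κ] {K : κ → Type*}
    [∀ l, Fintype (K l)] {p q : ℝ} (hpq : p.HolderConjugate q) (hp₂ : p ≤ 2)
    {μ : α → ℝ} {ν : κ → ℝ} (hμ : ∀ a, 0 ≤ μ a) (hν : ∀ l, 0 ≤ ν l)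
    {Φ : α → (Σ l, K l) → ℂ} (h₀ : ∀ a l, ∑ k, ‖Φ a ⟨l, k⟩‖ ≤ μ a * ν l)
    (h₁ : ∀ (x : α → ℂ) (y : (Σ l, K l) → ℂ), ‖∑ a, ∑ b, x a * y b * Φ a b‖
      ≤ √(∑ a, μ a * ‖x a‖ ^ 2) * √(∑ b : Σ l, K l, ν b.1 * ‖y b‖ ^ 2))
    {s : α → ℝ} {γ : κ → ℝ} {d : (Σ l, K l) → ℝ} (hs : ∀ a, 0 ≤ s a) (hγ : ∀ l, 0 ≤ γ l)
    (hd : ∀ b, 0 ≤ d b) (hd₁ : ∀ l, ∑ k, d ⟨l, k⟩ ^ q ≤ 1) :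
    ‖∑ a, ∑ b : Σ l, K l, (s a : ℂ) * ((γ b.1 : ℂ) * (d b : ℂ)) * Φ a b‖
      ≤ (∑ a, μ a * s a ^ p) ^ (1 / p) * (∑ l, ν l * γ l ^ p) ^ (1 / p) := by
  have hp0 : 0 < p := hpq.pos
  have hq0 : 0 < q := hpq.symm.pos
  have hq2 : 2 ≤ q := by
    have h := hpq.inv_add_inv_eq_one
    have h1 : 2⁻¹ ≤ p⁻¹ := inv_anti₀ hp0 hp₂
    have h2 : q⁻¹ ≤ 2⁻¹ := by norm_num at *; linarith
    exact (inv_le_inv₀ hq0 two_pos).1 h2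
  -- The exponents are affine in `z` and chosen so that all equal `1` at `z = 2 / q`, which lies in
  -- `[0, 1]` since `q ≥ 2`. On `Re z = 0` the powers are `s ^ p`, `γ ^ p` and `d ^ 0`, on `Re z =
  -- 1` they are `s ^ (p / 2)`, `γ ^ (p / 2)` and `d ^ (q / 2)`, which fits the two hypotheses.
  let A : ℂ → α → ℂ := fun z a => cutPow (s a) (p * (1 - z / 2))
  let B : ℂ → (Σ l, K l) → ℂ := fun z b =>
    cutPow (γ b.1) (p * (1 - z / 2)) * cutPow (d b) (q * z / 2)
  let F : ℂ → ℂ := fun z => ∑ a, ∑ b, A z a * B z b * Φ a b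
  set S := ∑ a, μ a * s a ^ p with hS
  set G := ∑ l, ν l * γ l ^ p with hG
  have hS0 : 0 ≤ S := Finset.sum_nonneg fun a _ => mul_nonneg (hμ a) (Real.rpow_nonneg (hs a) _)
  have hG0 : 0 ≤ G := Finset.sum_nonneg fun a _ => mul_nonneg (hν a) (Real.rpow_nonneg (hγ a) _)
  have re₁ : ∀ z : ℂ, ((p : ℂ) * (1 - z / 2)).re = p * (1 - z.re / 2) := fun z => by simp
  have re₂ : ∀ z : ℂ, ((q : ℂ) * z / 2).re = q * z.re / 2 := fun z => by simp
  have hAn : ∀ z a, ‖A z a‖ ≤ s a ^ (p * (1 - z.re / 2)) := fun z a => by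
    rw [← re₁]; exact norm_cutPow_le (hs a) _
  have hBn : ∀ z b, ‖B z b‖ ≤ γ b.1 ^ (p * (1 - z.re / 2)) * d b ^ (q * z.re / 2) := fun z b => by
    rw [← re₁, ← re₂, norm_mul]
    exact mul_le_mul (norm_cutPow_le (hγ _) _) (norm_cutPow_le (hd _) _) (norm_nonneg _)
      (Real.rpow_nonneg (hγ _) _)
  have hdiff : Differentiable ℂ F := by
    refine Differentiable.fun_sum fun a _ => Differentiable.fun_sum fun b _ => ?_
    refine Differentiable.mul_const (Differentiable.mul ?_ (Differentiable.mul ?_ ?_)) _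
    · exact (differentiable_cutPow _).comp (by fun_prop)
    · exact (differentiable_cutPow _).comp (by fun_prop)
    · exact (differentiable_cutPow _).comp (by fun_prop)
  have hbdd : BddAbove ((norm ∘ F) '' Complex.HadamardThreeLines.verticalClosedStrip 0 1) := by
    refine ⟨∑ a, ∑ b : Σ l, K l,
      (1 + s a) ^ p * ((1 + γ b.1) ^ p * (1 + d b) ^ q) * ‖Φ a b‖, ?_⟩
    rintro _ ⟨z, hz, rfl⟩
    have hz' : 0 ≤ z.re ∧ z.re ≤ 1 := hz
    refine (norm_sum_le _ _).trans (Finset.sum_le_sum fun a _ => ?_)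
    refine (norm_sum_le _ _).trans (Finset.sum_le_sum fun b _ => ?_)
    rw [norm_mul, norm_mul]
    have e1 : 0 ≤ p * (1 - z.re / 2) := mul_nonneg hp0.le (by linarith)
    have e2 : p * (1 - z.re / 2) ≤ p := by nlinarith
    have e3 : 0 ≤ q * z.re / 2 := by have := mul_nonneg hq0.le hz'.1; linarith
    have e4 : q * z.re / 2 ≤ q := by nlinarith
    have n1 := (hAn z a).trans (rpow_le_one_add_rpow (hs a) e1 e2)
    have n2 := (hBn z b).trans (mul_le_mul (rpow_le_one_add_rpow (hγ b.1) e1 e2)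
      (rpow_le_one_add_rpow (hd b) e3 e4) (Real.rpow_nonneg (hd b) _)
      (Real.rpow_nonneg (by linarith [hγ b.1]) _))
    gcongr
    exact Real.rpow_nonneg (by linarith [hs a]) _
  -- Here the factor from `d` has modulus at most one, so the sum over `k` is controlled by `h₀`.
  have hedge₀ : ∀ z ∈ Complex.re ⁻¹' {0}, ‖F z‖ ≤ S * G := by
    intro z hz
    have hz0 : z.re = 0 := hz
    calc ‖F z‖ ≤ ∑ a, ∑ b : Σ l, K l, s a ^ p * γ b.1 ^ p * ‖Φ a b‖ := by
          refine (norm_sum_le _ _).trans (Finset.sum_le_sum fun a _ => ?_)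
          refine (norm_sum_le _ _).trans (Finset.sum_le_sum fun b _ => ?_)
          rw [norm_mul, norm_mul]
          have n1 := hAn z a
          have n2 := hBn z b
          simp only [hz0, zero_div, sub_zero, mul_one, mul_zero, Real.rpow_zero] at n1 n2
          gcongr
          exact Real.rpow_nonneg (hs a) _
      _ = ∑ a, ∑ l, s a ^ p * γ l ^ p * ∑ k, ‖Φ a ⟨l, k⟩‖ := by
          simp only [Fintype.sum_sigma, Finset.mul_sum]
      _ ≤ ∑ a, ∑ l, s a ^ p * γ l ^ p * (μ a * ν l) := by
          refine Finset.sum_le_sum fun a _ => Finset.sum_le_sum fun l _ => ?_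
          exact mul_le_mul_of_nonneg_left (h₀ a l)
            (mul_nonneg (Real.rpow_nonneg (hs a) _) (Real.rpow_nonneg (hγ l) _))
      _ = S * G := by
          rw [hS, hG, Finset.sum_mul_sum]
          exact Finset.sum_congr rfl fun a _ => Finset.sum_congr rfl fun l _ => by ring
  have hsq : ∀ x r : ℝ, 0 ≤ x → (x ^ (r / 2)) ^ 2 = x ^ r := fun x r hx => by
    rw [← Real.rpow_natCast, ← Real.rpow_mul hx]; congr 1; push_cast; ring
  have hedge₁ : ∀ z ∈ Complex.re ⁻¹' {1}, ‖F z‖ ≤ √S * √G := by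
    intro z hz
    have hz1 : z.re = 1 := hz
    refine (h₁ (A z) (B z)).trans ?_
    gcongr
    · rw [hS]
      refine Finset.sum_le_sum fun a _ => mul_le_mul_of_nonneg_left ?_ (hμ a)
      have n1 := hAn z a
      rw [hz1, show p * (1 - 1 / 2) = p / 2 by ring] at n1
      rw [← hsq _ _ (hs a)]
      gcongr
    · rw [hG, Fintype.sum_sigma]
      refine Finset.sum_le_sum fun l _ => ?_
      calc ∑ k, ν l * ‖B z ⟨l, k⟩‖ ^ 2 ≤ ∑ k, ν l * γ l ^ p * d ⟨l, k⟩ ^ q := by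
            refine Finset.sum_le_sum fun k _ => ?_
            rw [mul_assoc]
            refine mul_le_mul_of_nonneg_left ?_ (hν l)
            have n1 := hBn z ⟨l, k⟩
            rw [hz1, show p * (1 - 1 / 2) = p / 2 by ring, mul_one] at n1
            rw [← hsq _ _ (hγ l), ← hsq _ _ (hd _), ← mul_pow]
            gcongr
        _ = ν l * γ l ^ p * ∑ k, d ⟨l, k⟩ ^ q := by rw [Finset.mul_sum]
        _ ≤ _ := mul_le_of_le_one_right (mul_nonneg (hν l) (Real.rpow_nonneg (hγ l) _)) (hd₁ l)
  have ht0 : 0 ≤ 2 / q := by positivity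
  have ht1 : 2 / q ≤ 1 := (div_le_one hq0).2 hq2
  have key := Complex.HadamardThreeLines.norm_le_interp_of_mem_verticalClosedStrip₀₁' F
    (z := ((2 / q : ℝ) : ℂ)) ⟨by simpa using ht0, by simpa using ht1⟩
    hdiff.diffContOnCl hbdd hedge₀ hedge₁
  have hqC : (q : ℂ) ≠ 0 := by exact_mod_cast hq0.ne'
  have hw1 : (p : ℂ) * (1 - ((2 / q : ℝ) : ℂ) / 2) = 1 := by
    have h : p * (1 - 2 / q / 2) = 1 := by
      have h := hpq.inv_add_inv_eq_one
      field_simp at h ⊢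
      linarith
    exact_mod_cast h
  have hw2 : (q : ℂ) * ((2 / q : ℝ) : ℂ) / 2 = 1 := by
    push_cast; field_simp
  have hF : F ((2 / q : ℝ) : ℂ) = ∑ a, ∑ b : Σ l, K l,
      (s a : ℂ) * ((γ b.1 : ℂ) * (d b : ℂ)) * Φ a b := by
    simp only [F, A, B, hw1, hw2, cutPow_one]
  rw [← hF]
  refine key.trans (le_of_eq ?_)
  -- The exponent of `S * G` is `(1 - 2 / q) + (1 / 2) * (2 / q) = 1 - 1 / q = 1 / p`.
  rw [Complex.ofReal_re, ← Real.sqrt_mul hS0, Real.sqrt_eq_rpow,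
    ← Real.rpow_mul (mul_nonneg hS0 hG0),
    ← Real.rpow_add_of_nonneg (mul_nonneg hS0 hG0) (by linarith) (by positivity),
    ← Real.mul_rpow hS0 hG0]
  congr 1
  have h := hpq.inv_add_inv_eq_one
  field_simp at h ⊢
  linarith

end Interpolation

/-! ### Finite rank operators and their norming functionals -/

section FiniteSVD

variable {H : Type*} [NormedAddCommGroup H] [InnerProductSpace ℂ H]

/-- A finite singular value decomposition `T = ∑ⱼ sⱼ ⟪uⱼ, ·⟫ vⱼ`, in which vanishing coefficients
are allowed. -/
structure FiniteSVD (T : H →L[ℂ] H) where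
  /-- the index set -/
  J : Type
  [fintype : Fintype J]
  /-- the coefficients -/
  s : J → ℝ
  /-- the right singular vectors -/
  u : J → H
  /-- the left singular vectors -/
  v : J → H
  s_nonneg : ∀ j, 0 ≤ s j
  orthonormal_u : Orthonormal ℂ u
  orthonormal_v : Orthonormal ℂ v
  apply_eq : ∀ x, T x = ∑ j, ((s j : ℂ) * ⟪u j, x⟫_ℂ) • v j

attribute [instance] FiniteSVD.fintype

namespace FiniteSVD

lemma apply_u {T : H →L[ℂ] H} (D : FiniteSVD T) (j : D.J) : T (D.u j) = (D.s j : ℂ) • D.v j := by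
  classical
  rw [D.apply_eq, Finset.sum_eq_single j]
  · rw [orthonormal_iff_ite.1 D.orthonormal_u, if_pos rfl, mul_one]
  · intro i _ hi
    rw [orthonormal_iff_ite.1 D.orthonormal_u, if_neg hi, mul_zero, zero_smul]
  · simp

lemma inner_v_apply_u {T : H →L[ℂ] H} (D : FiniteSVD T) (j : D.J) :
    ⟪D.v j, T (D.u j)⟫_ℂ = D.s j := by
  rw [D.apply_u, inner_smul_right, inner_self_eq_norm_sq_to_K, D.orthonormal_v.1]
  simp

/-- The zero operator has the empty decomposition. -/
def zero : FiniteSVD (0 : H →L[ℂ] H) where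
  J := Empty
  s := Empty.elim
  u := Empty.elim
  v := Empty.elim
  s_nonneg := fun j => j.elim
  orthonormal_u := ⟨fun j => j.elim, fun j => j.elim⟩
  orthonormal_v := ⟨fun j => j.elim, fun j => j.elim⟩
  apply_eq := by simp

variable {p : ℝ} [hp : Fact (1 ≤ p)]

/-- Both variational bounds apply directly to a finite decomposition, without appeal to the spectral
theorem. -/
lemma norm_rpow_eq {T : SchattenClass H p} (D : FiniteSVD (SchattenClass.inclₗ T)) :
    ‖T‖ ^ p = ∑ j, D.s j ^ p := by
  have hp0 : 0 < p := zero_lt_one.trans_le hp.out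
  have h : variationalNorm p (SchattenClass.inclₗ T) = (∑' j, ‖D.s j‖ₑ ^ p) ^ (1 / p) :=
    le_antisymm (variationalNorm_le_of_hasSum hp.out D.orthonormal_u D.orthonormal_v fun x y =>
        hasSum_inner_of_hasSum (by rw [D.apply_eq]; exact hasSum_fintype _) y)
      (tsum_rpow_le_variationalNorm hp0 D.orthonormal_u D.orthonormal_v D.apply_u)
  rw [SchattenClass.norm_def, h, ← ENNReal.toReal_rpow, one_div,
    Real.rpow_inv_rpow ENNReal.toReal_nonneg hp0.ne', tsum_fintype, ENNReal.toReal_sum]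
  · refine Finset.sum_congr rfl fun j _ => ?_
    rw [← ENNReal.toReal_rpow, toReal_enorm, Real.norm_of_nonneg (D.s_nonneg j)]
  · intro j _
    exact ENNReal.rpow_ne_top_of_nonneg hp0.le enorm_ne_top

/-- The weights of the norming functional of an operator with a finite singular value
decomposition. -/
def weight {T : SchattenClass H p} (D : FiniteSVD (SchattenClass.inclₗ T)) (k : D.J) : ℝ :=
  (D.s k / ‖T‖) ^ (p - 1)

lemma weight_nonneg {T : SchattenClass H p} (D : FiniteSVD (SchattenClass.inclₗ T)) (k : D.J) :
    0 ≤ D.weight k :=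
  Real.rpow_nonneg (div_nonneg (D.s_nonneg k) (norm_nonneg _)) _

/-- Since `(p - 1) q = p`, the sum is `‖T‖ ^ p / ‖T‖ ^ p`. It is `1` unless `T = 0`, when division
by zero makes it `0`. -/
lemma sum_weight_rpow_le {q : ℝ} (hpq : p.HolderConjugate q) {T : SchattenClass H p}
    (D : FiniteSVD (SchattenClass.inclₗ T)) : ∑ k, D.weight k ^ q ≤ 1 := by
  have h1 : ∀ k, D.weight k ^ q = D.s k ^ p / ‖T‖ ^ p := fun k => by
    rw [weight, ← Real.rpow_mul (div_nonneg (D.s_nonneg k) (norm_nonneg _)),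
      hpq.sub_one_mul_conj, Real.div_rpow (D.s_nonneg k) (norm_nonneg _)]
  simp only [h1, ← Finset.sum_div, ← D.norm_rpow_eq]
  exact div_self_le_one _

/-- The norming functional `Y ↦ ‖T‖ ^ (q - 1) ∑ₖ wₖ ⟪vₖ, Y uₖ⟫` for the `q`-th power of the norm. -/
def dual {T : SchattenClass H p} (D : FiniteSVD (SchattenClass.inclₗ T)) (q : ℝ) :
    SchattenClass H p →L[ℂ] ℂ :=
  ∑ k, (((‖T‖ ^ (q - 1) : ℝ) : ℂ) * (D.weight k : ℂ)) •
    ((innerSL ℂ (D.v k)) ∘L (ContinuousLinearMap.apply ℂ H (D.u k)) ∘L SchattenClass.incl)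

lemma dual_apply {T : SchattenClass H p} (D : FiniteSVD (SchattenClass.inclₗ T)) (q : ℝ)
    (Y : SchattenClass H p) : D.dual q Y = ∑ k, ((‖T‖ ^ (q - 1) : ℝ) : ℂ) * (D.weight k : ℂ) *
      ⟪D.v k, SchattenClass.inclₗ Y (D.u k)⟫_ℂ := by
  simp [dual]

/-- The weights contribute `∑ₖ sₖ ^ p = ‖T‖ ^ p`, and the exponents add up to `(q - 1) - (p - 1) + p
= q`. -/
lemma dual_apply_self {q : ℝ} (hpq : p.HolderConjugate q) {T : SchattenClass H p}
    (D : FiniteSVD (SchattenClass.inclₗ T)) : D.dual q T = ((‖T‖ ^ q : ℝ) : ℂ) := by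
  simp only [dual_apply, inner_v_apply_u]
  have hq1 : 0 < q - 1 := hpq.symm.sub_one_pos
  have hp1 : 0 < p - 1 := hpq.sub_one_pos
  norm_cast
  rcases eq_or_lt_of_le (norm_nonneg T) with h0 | h0
  · rw [← h0, Real.zero_rpow hq1.ne', Real.zero_rpow hpq.symm.ne_zero]
    simp
  have h1 : ∀ k, ‖T‖ ^ (q - 1) * D.weight k * D.s k
      = ‖T‖ ^ (q - 1) * (‖T‖ ^ (p - 1))⁻¹ * D.s k ^ p := fun k => by
    rw [weight, Real.div_rpow (D.s_nonneg k) h0.le]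
    rcases eq_or_lt_of_le (D.s_nonneg k) with hk | hk
    · rw [← hk, Real.zero_rpow hpq.ne_zero]; simp
    · rw [show D.s k ^ p = D.s k ^ (p - 1) * D.s k by
        rw [← Real.rpow_add_one hk.ne']; ring_nf]
      ring
  rw [Finset.sum_congr rfl fun k _ => h1 k, ← Finset.mul_sum, ← D.norm_rpow_eq,
    ← Real.rpow_neg h0.le, ← Real.rpow_add h0, ← Real.rpow_add h0]
  ring_nf

/-- Hölder's inequality: the weights lie in the unit ball of `ℓ^q`, and the singular vectors of `T`
are admissible test families for the variational norm of `Y`. -/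
lemma norm_dual_apply_le {q : ℝ} (hpq : p.HolderConjugate q) {T : SchattenClass H p}
    (D : FiniteSVD (SchattenClass.inclₗ T)) (Y : SchattenClass H p) :
    ‖D.dual q Y‖ ≤ ‖T‖ ^ (q - 1) * ‖Y‖ := by
  have hp0 : 0 < p := hpq.pos
  have hY : (∑ k, ‖⟪D.v k, SchattenClass.inclₗ Y (D.u k)⟫_ℂ‖ ^ p) ^ (1 / p) ≤ ‖Y‖ := by
    have h := sum_inner_rpow_le_variationalNorm p (SchattenClass.inclₗ Y) D.orthonormal_u
      D.orthonormal_v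
    have h' := ENNReal.toReal_mono Y.variationalNorm_ne_top h
    rw [← ENNReal.toReal_rpow, ENNReal.toReal_sum] at h'
    · simpa only [← ENNReal.toReal_rpow, toReal_enorm, SchattenClass.norm_def] using h'
    · intro j _
      exact ENNReal.rpow_ne_top_of_nonneg hp0.le enorm_ne_top
  calc ‖D.dual q Y‖
      ≤ ∑ k, ‖T‖ ^ (q - 1) * (D.weight k * ‖⟪D.v k, SchattenClass.inclₗ Y (D.u k)⟫_ℂ‖) := by
        rw [dual_apply]
        refine (norm_sum_le _ _).trans (Finset.sum_le_sum fun k _ => le_of_eq ?_)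
        rw [norm_mul, norm_mul, Complex.norm_real, Complex.norm_real,
          Real.norm_of_nonneg (D.weight_nonneg k),
          Real.norm_of_nonneg (Real.rpow_nonneg (norm_nonneg _) _), mul_assoc]
    _ = ‖T‖ ^ (q - 1) * ∑ k, D.weight k * ‖⟪D.v k, SchattenClass.inclₗ Y (D.u k)⟫_ℂ‖ := by
        rw [Finset.mul_sum]
    _ ≤ ‖T‖ ^ (q - 1) * (1 * ‖Y‖) := by
        refine mul_le_mul_of_nonneg_left ?_ (Real.rpow_nonneg (norm_nonneg _) _)
        refine (Real.inner_le_Lp_mul_Lq_of_nonneg _ hpq.symm (fun k _ => D.weight_nonneg k)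
          fun k _ => norm_nonneg _).trans ?_
        refine mul_le_mul ?_ hY (by positivity) zero_le_one
        refine Real.rpow_le_one (Finset.sum_nonneg fun k _ => Real.rpow_nonneg (D.weight_nonneg k) _)
          (D.sum_weight_rpow_le hpq) ?_
        have := hpq.symm.pos
        positivity
    _ = _ := by rw [one_mul]

end FiniteSVD

end FiniteSVD

/-! ### The dual inequality for step functions -/

section StepFunctions

variable {V : Type*} [NormedAddCommGroup V] [InnerProductSpace ℝ V] [FiniteDimensional ℝ V]
  [MeasurableSpace V] [BorelSpace V]
  {H : Type*} [NormedAddCommGroup H] [InnerProductSpace ℂ H] [CompleteSpace H]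
  {p : ℝ} [hp : Fact (1 ≤ p)]

/-- The Hausdorff-Young inequality for step functions, in the dual form. -/
lemma norm_sum_dual_fourierPairing_le {q : ℝ} (hpq : p.HolderConjugate q) (hp₂ : p ≤ 2)
    {ι κ : Type*} [Fintype ι] [Fintype κ] {A : ι → Set V}
    {B : κ → Set V} (hA : ∀ i, MeasurableSet (A i)) (hA' : ∀ i, volume (A i) ≠ ∞)
    (hAd : Pairwise (Function.onFun Disjoint A)) (hB : ∀ l, MeasurableSet (B l))
    (hB' : ∀ l, volume (B l) ≠ ∞) (hBd : Pairwise (Function.onFun Disjoint B))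
    {T : ι → SchattenClass H p} (D : ∀ i, FiniteSVD (SchattenClass.inclₗ (T i)))
    {S : κ → SchattenClass H p} (E : ∀ l, FiniteSVD (SchattenClass.inclₗ (S l))) :
    ‖∑ l, (E l).dual q (∑ i, fourierPairing (A i) (B l) • T i)‖
      ≤ (∑ i, volume.real (A i) * ‖T i‖ ^ p) ^ (1 / p) *
        (∑ l, volume.real (B l) * ‖S l‖ ^ q) ^ (1 / p) := by
  let Φ : (Σ i, (D i).J) → (Σ l, (E l).J) → ℂ := fun a b =>
    ⟪(E b.1).v b.2, (D a.1).v a.2⟫_ℂ * ⟪(D a.1).u a.2, (E b.1).u b.2⟫_ℂ *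
      fourierPairing (A a.1) (B b.1)
  -- Bessel's inequality for both families of singular vectors, combined through the inequality of
  -- the means, bounds the sum of the products by one. This is the trace class endpoint.
  have h₀ : ∀ a l, ∑ k, ‖Φ a ⟨l, k⟩‖ ≤ volume.real (A a.1) * volume.real (B l) := by
    intro a l
    simp only [Φ, norm_mul, ← Finset.sum_mul]
    refine (mul_le_of_le_one_left (norm_nonneg _) ?_).trans
      (norm_fourierPairing_le (hA a.1) (hB' l))
    have b1 := (E l).orthonormal_v.sum_inner_products_le ((D a.1).v a.2) (s := Finset.univ)
    have b2 := (E l).orthonormal_u.sum_inner_products_le ((D a.1).u a.2) (s := Finset.univ)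
    rw [(D a.1).orthonormal_v.1, one_pow] at b1
    rw [(D a.1).orthonormal_u.1, one_pow] at b2
    calc ∑ k, ‖⟪(E l).v k, (D a.1).v a.2⟫_ℂ‖ * ‖⟪(D a.1).u a.2, (E l).u k⟫_ℂ‖
        ≤ ∑ k, (‖⟪(E l).v k, (D a.1).v a.2⟫_ℂ‖ ^ 2 + ‖⟪(E l).u k, (D a.1).u a.2⟫_ℂ‖ ^ 2) / 2 := by
          refine Finset.sum_le_sum fun k _ => ?_
          rw [norm_inner_symm ((D a.1).u a.2)]
          nlinarith [sq_nonneg (‖⟪(E l).v k, (D a.1).v a.2⟫_ℂ‖ - ‖⟪(E l).u k, (D a.1).u a.2⟫_ℂ‖)]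
      _ ≤ 1 := by
          rw [← Finset.sum_div, Finset.sum_add_distrib]
          linarith
  have h₁ : ∀ (x : (Σ i, (D i).J) → ℂ) (y : (Σ l, (E l).J) → ℂ),
      ‖∑ a, ∑ b, x a * y b * Φ a b‖
        ≤ √(∑ a : Σ i, (D i).J, volume.real (A a.1) * ‖x a‖ ^ 2) *
          √(∑ b : Σ l, (E l).J, volume.real (B b.1) * ‖y b‖ ^ 2) := fun x y =>
    norm_sum_sigma_mul_fourierPairing_le (J := fun i => (D i).J) (K := fun l => (E l).J)
      hA hA' hAd hB hB' hBd
      (fun i => (D i).orthonormal_u) (fun i => (D i).orthonormal_v)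
      (fun l => (E l).orthonormal_u) (fun l => (E l).orthonormal_v) x y
  -- The test coefficients factor as `‖S l‖ ^ (q - 1)` times the dual weight; the `p`-th power of
  -- the first factor is `‖S l‖ ^ q`.
  have key := norm_sum_mul_le_of_interpolation (K := fun l => (E l).J) hpq hp₂ (Φ := Φ)
    (μ := fun a : Σ i, (D i).J => volume.real (A a.1)) (ν := fun l => volume.real (B l))
    (fun _ => measureReal_nonneg) (fun _ => measureReal_nonneg) h₀ h₁
    (s := fun a => (D a.1).s a.2) (γ := fun l => ‖S l‖ ^ (q - 1)) (d := fun b => (E b.1).weight b.2)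
    (fun a => (D a.1).s_nonneg a.2) (fun l => Real.rpow_nonneg (norm_nonneg _) _)
    (fun b => (E b.1).weight_nonneg b.2) (fun l => (E l).sum_weight_rpow_le hpq)
  have e1 : ∑ a : Σ i, (D i).J, volume.real (A a.1) * (D a.1).s a.2 ^ p
      = ∑ i, volume.real (A i) * ‖T i‖ ^ p := by
    rw [Fintype.sum_sigma]
    exact Finset.sum_congr rfl fun i _ => by rw [(D i).norm_rpow_eq, Finset.mul_sum]
  have e2 : ∀ l, (‖S l‖ ^ (q - 1)) ^ p = ‖S l‖ ^ q := fun l => by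
    rw [← Real.rpow_mul (norm_nonneg _), hpq.symm.sub_one_mul_conj]
  simp only [e1, e2] at key
  refine le_trans (le_of_eq ?_) key
  congr 1
  rw [Finset.sum_comm, Fintype.sum_sigma]
  refine Finset.sum_congr rfl fun l _ => ?_
  rw [FiniteSVD.dual_apply]
  refine Finset.sum_congr rfl fun k _ => ?_
  rw [map_sum, sum_apply, inner_sum, Finset.mul_sum, Fintype.sum_sigma]
  refine Finset.sum_congr rfl fun i _ => ?_
  rw [map_smul, smul_apply, inner_smul_right, (D i).apply_eq, inner_sum, Finset.mul_sum,
    Finset.mul_sum]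
  refine Finset.sum_congr rfl fun j _ => ?_
  rw [inner_smul_right]
  ring

end StepFunctions

/-! ### Density of simple functions with finite rank values -/

section Truncation

variable {H : Type*} [NormedAddCommGroup H] [InnerProductSpace ℂ H]

lemma isCompactOperator_smulRight_innerSL (u v : H) :
    IsCompactOperator ((innerSL ℂ u).smulRight v : H →L[ℂ] H) := by
  have h : IsCompactOperator (id : ℂ → ℂ) :=
    (isCompactOperator_id_iff_finiteDimensional (𝕜 := ℂ)).2 inferInstance
  have h2 := (h.comp_clm (innerSL ℂ u)).clm_comp (ContinuousLinearMap.toSpanSingleton ℂ v)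
  have e : ⇑((innerSL ℂ u).smulRight v : H →L[ℂ] H)
      = ⇑(ContinuousLinearMap.toSpanSingleton ℂ v) ∘ id ∘ ⇑(innerSL ℂ u) := by
    ext x; simp
  rw [e]
  exact h2

variable [CompleteSpace H] {p : ℝ} [hp : Fact (1 ≤ p)]

/-- The singular value expansion is cut off at a finite set whose tail is small in `ℓ^p`. The error
is relative to `‖T‖` so that it stays integrable when applied pointwise to a function. -/
lemma exists_finiteSVD_norm_sub_le (T : SchattenClass H p) {ε : ℝ} (hε : 0 < ε) :
    ∃ T' : SchattenClass H p, Nonempty (FiniteSVD (SchattenClass.inclₗ T')) ∧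
      ‖T' - T‖ ≤ ε * ‖T‖ := by
  have hp0 : 0 < p := zero_lt_one.trans_le hp.out
  by_cases hT : T = 0
  · exact ⟨0, ⟨by rw [map_zero]; exact FiniteSVD.zero⟩, by simp [hT]⟩
  obtain ⟨J, s, u, v, hs, hu, hv, hAu, hsum, hn⟩ :=
    exists_singularValueDecomposition T.isCompactOperator
  have hfin : ∑' j, ‖s j‖ₑ ^ p ≠ ∞ := fun h => by
    have h2 := hn p
    rw [h, ENNReal.top_rpow_of_pos (by positivity),
      schattenNorm_eq_variationalNorm hp.out T.isCompactOperator] at h2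
    exact T.variationalNorm_ne_top h2
  have hδ : 0 < ε * ‖T‖ := mul_pos hε (norm_pos_iff.2 hT)
  have hpos : 0 < ENNReal.ofReal (ε * ‖T‖) ^ p :=
    ENNReal.rpow_pos (ENNReal.ofReal_pos.2 hδ) ENNReal.ofReal_ne_top
  obtain ⟨F, hF⟩ := ((ENNReal.tendsto_tsum_compl_atTop_zero hfin).eventually
    (gt_mem_nhds hpos)).exists
  let R : H →L[ℂ] H := ∑ j ∈ F, (s j : ℂ) • (innerSL ℂ (u j)).smulRight (v j)
  have hR : ∀ x, R x = ∑ j ∈ F, ((s j : ℂ) * ⟪u j, x⟫_ℂ) • v j := fun x => by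
    simp [R, mul_smul]
  have hRc : IsCompactOperator R := by
    have : R ∈ compactOperator (RingHom.id ℂ) H H :=
      Submodule.sum_mem _ fun j _ => Submodule.smul_mem _ _
        (isCompactOperator_smulRight_innerSL (u j) (v j))
    exact this
  have hsub : variationalNorm p (SchattenClass.inclₗ T - R) ≤ ENNReal.ofReal (ε * ‖T‖) := by
    have h1 : ∀ x, HasSum (fun j : {j // j ∉ F} => ((s j : ℂ) * ⟪u j, x⟫_ℂ) • v j)
        ((SchattenClass.inclₗ T - R) x) := fun x => by
      refine (F.hasSum_compl_iff (f := fun j => ((s j : ℂ) * ⟪u j, x⟫_ℂ) • v j)).2 ?_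
      have := hsum x
      rwa [sub_apply, hR, sub_add_cancel]
    have h2 := variationalNorm_le_of_hasSum hp.out (s := fun j : {j // j ∉ F} => s j)
      (hu.comp ((↑) : {j // j ∉ F} → J) Subtype.coe_injective)
      (hv.comp ((↑) : {j // j ∉ F} → J) Subtype.coe_injective)
      fun x y => hasSum_inner_of_hasSum (h1 x) y
    refine h2.trans ?_
    calc _ ≤ (ENNReal.ofReal (ε * ‖T‖) ^ p) ^ (1 / p) := by gcongr
      _ = _ := by rw [one_div, ENNReal.rpow_rpow_inv hp0.ne']
  let Δ : SchattenClass H p := SchattenClass.mk (SchattenClass.inclₗ T - R)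
    (T.isCompactOperator.sub hRc) (hsub.trans_lt ENNReal.ofReal_lt_top)
  refine ⟨T - Δ, ⟨?_⟩, ?_⟩
  · have : SchattenClass.inclₗ (T - Δ) = R := by
      rw [map_sub, SchattenClass.inclₗ_mk, sub_sub_cancel]
    rw [this]
    exact
      { J := F
        s := fun j => s j
        u := fun j => u j
        v := fun j => v j
        s_nonneg := fun j => (hs j).le
        orthonormal_u := hu.comp _ Subtype.coe_injective
        orthonormal_v := hv.comp _ Subtype.coe_injective
        apply_eq := fun x => by
          rw [hR, Finset.sum_coe_sort F (fun j => ((s j : ℂ) * ⟪u j, x⟫_ℂ) • v j)] }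
  · rw [sub_sub_cancel_left, norm_neg, SchattenClass.norm_def, SchattenClass.inclₗ_mk]
    exact ENNReal.toReal_le_of_le_ofReal hδ.le hsub

/-- The values of a standard simple approximation are truncated with relative error `1 / (m + 1)`.
One sequence serves every exponent `r`, so convergence in `L¹` and in `L^p` is available
simultaneously. -/
lemma exists_simpleFunc_finiteSVD_tendsto {Ω : Type*} [MeasurableSpace Ω] {μ : Measure Ω}
    {f : Ω → SchattenClass H p} (hf : StronglyMeasurable f) :
    ∃ h : ℕ → SimpleFunc Ω (SchattenClass H p),
      (∀ m x, Nonempty (FiniteSVD (SchattenClass.inclₗ (h m x)))) ∧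
      ∀ r : ℝ≥0∞, r ≠ ∞ → 1 ≤ r → MemLp f r μ → (∀ m, MemLp (h m) r μ) ∧
        Tendsto (fun m => eLpNorm (⇑(h m) - f) r μ) atTop (𝓝 0) := by
  let _ : MeasurableSpace (SchattenClass H p) := borel _
  have _ : BorelSpace (SchattenClass H p) := ⟨rfl⟩
  have hsep : TopologicalSpace.SeparableSpace
      (Set.range f ∪ {0} : Set (SchattenClass H p)) :=
    hf.separableSpace_range_union_singleton
  let a : ℕ → SimpleFunc Ω (SchattenClass H p) := fun m =>
    SimpleFunc.approxOn f hf.measurable (Set.range f ∪ {0}) 0 (by simp) m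
  have hε : ∀ m : ℕ, (0 : ℝ) < 1 / ((m : ℝ) + 1) := fun m => by positivity
  choose R hR₁ hR₂ using fun (m : ℕ) (T : SchattenClass H p) =>
    exists_finiteSVD_norm_sub_le T (hε m)
  refine ⟨fun m => (a m).map (R m), fun m x => hR₁ m _, fun r hr hr1 hfr => ?_⟩
  have ha : ∀ m, MemLp (a m) r μ := fun m =>
    SimpleFunc.memLp_approxOn_range hf.measurable hfr m
  have hat : Tendsto (fun m => eLpNorm (⇑(a m) - f) r μ) atTop (𝓝 0) :=
    SimpleFunc.tendsto_approxOn_range_Lp_eLpNorm hr hf.measurable hfr.2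
  have hm : ∀ m, MemLp (⇑((a m).map (R m)) - ⇑(a m)) r μ := fun m => by
    refine (ha m).of_le_mul (c := 1 / ((m : ℝ) + 1)) ?_ (.of_forall fun x => hR₂ m _)
    exact (((a m).map (R m)).aestronglyMeasurable).sub (a m).aestronglyMeasurable
  refine ⟨fun m => ?_, ?_⟩
  · simpa using (hm m).add (ha m)
  have hb : ∀ m, eLpNorm (⇑((a m).map (R m)) - f) r μ
      ≤ ENNReal.ofReal (1 / ((m : ℝ) + 1)) * (eLpNorm (⇑(a m) - f) r μ + eLpNorm f r μ)
        + eLpNorm (⇑(a m) - f) r μ := fun m => by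
    have e1 : ⇑((a m).map (R m)) - f = (⇑((a m).map (R m)) - ⇑(a m)) + (⇑(a m) - f) := by abel
    rw [e1]
    refine (eLpNorm_add_le (hm m).1 ((ha m).sub hfr).1 hr1).trans ?_
    gcongr
    refine (eLpNorm_le_mul_eLpNorm_of_ae_le_mul (g := a m) (.of_forall fun x => hR₂ m _) r).trans ?_
    gcongr
    have e2 : ⇑(a m) = (⇑(a m) - f) + f := by abel
    conv_lhs => rw [e2]
    exact eLpNorm_add_le ((ha m).sub hfr).1 hfr.1 hr1
  have hlim : Tendsto (fun m : ℕ => ENNReal.ofReal (1 / ((m : ℝ) + 1)) *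
      (eLpNorm (⇑(a m) - f) r μ + eLpNorm f r μ) + eLpNorm (⇑(a m) - f) r μ) atTop (𝓝 0) := by
    have h1 : Tendsto (fun m : ℕ => ENNReal.ofReal (1 / ((m : ℝ) + 1))) atTop (𝓝 0) := by
      simpa using ENNReal.tendsto_ofReal tendsto_one_div_add_atTop_nhds_zero_nat
    have h2 := ENNReal.Tendsto.mul h1 (Or.inr (by simpa using hfr.2.ne))
      (hat.add (tendsto_const_nhds (x := eLpNorm f r μ))) (Or.inr ENNReal.zero_ne_top)
    simpa using h2.add hat
  exact tendsto_of_tendsto_of_tendsto_of_le_of_le tendsto_const_nhds hlim (fun _ => zero_le) hb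

end Truncation

/-! ### Simple functions as finite sums over their nonzero values -/

section SimpleFunctions

variable {V : Type*} [MeasurableSpace V] {X : Type*} [NormedAddCommGroup X]

open Classical in
/-- The finite set of nonzero values of a simple function. -/
def MeasureTheory.SimpleFunc.nonzeroRange (f : SimpleFunc V X) : Finset X :=
  f.range.filter (· ≠ 0)

lemma MeasureTheory.SimpleFunc.ne_zero_of_mem_nonzeroRange {f : SimpleFunc V X}
    (i : f.nonzeroRange) : (i : X) ≠ 0 := by
  classical
  exact (Finset.mem_filter.1 i.2).2

lemma MeasureTheory.SimpleFunc.exists_eq_of_mem_nonzeroRange {f : SimpleFunc V X}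
    (i : f.nonzeroRange) : ∃ x, f x = i := by
  classical
  exact SimpleFunc.mem_range.1 (Finset.mem_filter.1 i.2).1

lemma MeasureTheory.SimpleFunc.pairwise_disjoint_preimage (f : SimpleFunc V X) :
    Pairwise (Function.onFun Disjoint fun i : f.nonzeroRange => f ⁻¹' {(i : X)}) := by
  intro i j hij
  refine Set.disjoint_left.2 fun x hi hj => hij (Subtype.ext ?_)
  exact (Set.mem_singleton_iff.1 hi).symm.trans hj

lemma MeasureTheory.SimpleFunc.comp_eq_sum_indicator (f : SimpleFunc V X) {Y : Type*}
    [AddCommMonoid Y] {g : X → Y} (hg : g 0 = 0) (x : V) :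
    g (f x) = ∑ i : f.nonzeroRange, (f ⁻¹' {(i : X)}).indicator (fun _ => g i) x := by
  classical
  by_cases hx : f x = 0
  · rw [hx, hg, Finset.sum_eq_zero]
    intro i _
    refine Set.indicator_of_notMem (fun h => f.ne_zero_of_mem_nonzeroRange i ?_) _
    exact (Set.mem_singleton_iff.1 h).symm.trans hx
  · let i₀ : f.nonzeroRange := ⟨f x, Finset.mem_filter.2 ⟨f.mem_range_self x, hx⟩⟩
    rw [Finset.sum_eq_single i₀]
    · rw [Set.indicator_of_mem]
      rfl
    · intro i _ hi
      refine Set.indicator_of_notMem (fun h => hi (Subtype.ext ?_)) _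
      exact (Set.mem_singleton_iff.1 h).symm
    · simp

variable [NormedAddCommGroup V] [InnerProductSpace ℝ V] [FiniteDimensional ℝ V] [BorelSpace V]

lemma MeasureTheory.SimpleFunc.integral_comp_eq_sum {f : SimpleFunc V X}
    (hf : ∀ i : f.nonzeroRange, volume (f ⁻¹' {(i : X)}) ≠ ∞) {g : X → ℝ} (hg : g 0 = 0) :
    ∫ x, g (f x) = ∑ i : f.nonzeroRange, volume.real (f ⁻¹' {(i : X)}) * g i := by
  simp only [f.comp_eq_sum_indicator hg]
  rw [integral_finsetSum _ fun i _ =>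
    integrable_indicator_const (f.measurableSet_preimage _) (hf i) _]
  refine Finset.sum_congr rfl fun i _ => ?_
  rw [integral_indicator (f.measurableSet_preimage _)]
  simp

lemma MeasureTheory.SimpleFunc.fourier_eq_sum [NormedSpace ℂ X] [CompleteSpace X]
    {f : SimpleFunc V X} (hf : ∀ i : f.nonzeroRange, volume (f ⁻¹' {(i : X)}) ≠ ∞) (ξ : V) :
    𝓕 (f : V → X) ξ = ∑ i : f.nonzeroRange, fourierIndicator (f ⁻¹' {(i : X)}) ξ • (i : X) := by
  have h : ∀ x, f x = ∑ i : f.nonzeroRange, (f ⁻¹' {(i : X)}).indicator (fun _ => (i : X)) x :=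
    f.comp_eq_sum_indicator (g := id) rfl
  rw [Real.fourier_eq]
  simp only [← fourier_indicator_const, Real.fourier_eq]
  rw [← integral_finsetSum]
  · refine integral_congr_ae (.of_forall fun x => ?_)
    simp only
    rw [h x, Finset.smul_sum]
  · intro i _
    rw [Real.fourierIntegral_convergent_iff]
    exact integrable_indicator_const (f.measurableSet_preimage _) (hf i) _

end SimpleFunctions

/-! ### Duality for step functions -/

section HausdorffYoung

variable {V : Type*} [NormedAddCommGroup V] [InnerProductSpace ℝ V] [FiniteDimensional ℝ V]
  [MeasurableSpace V] [BorelSpace V]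
  {H : Type*} [NormedAddCommGroup H] [InnerProductSpace ℂ H] [CompleteSpace H]
  {p : ℝ} [hp : Fact (1 ≤ p)]

lemma le_add_of_le_mul_rpow_add {S M δ p q : ℝ} (hpq : p.HolderConjugate q) (hS : 0 ≤ S)
    (hM : 0 ≤ M) (hδ : 0 ≤ δ) (h : S ≤ M * S ^ (1 / p) + S ^ (1 / p) * δ) :
    S ^ (1 / q) ≤ M + δ := by
  rcases eq_or_lt_of_le hS with h0 | h0
  · rw [← h0, Real.zero_rpow (one_div_ne_zero hpq.symm.ne_zero)]
    exact add_nonneg hM hδ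
  have hpos : 0 < S ^ (1 / p) := Real.rpow_pos_of_pos h0 _
  refine le_of_mul_le_mul_left ?_ hpos
  rw [← Real.rpow_add h0, one_div, one_div, hpq.inv_add_inv_eq_one, Real.rpow_one]
  rw [one_div] at h
  linarith

/-- The duality step of the Hausdorff-Young inequality for simple functions with values of finite
rank. -/
lemma integral_rpow_le_of_finiteSVD {q : ℝ} (hpq : p.HolderConjugate q) (hp₂ : p ≤ 2)
    {f h : SimpleFunc V (SchattenClass H p)}
    (hfD : ∀ x, Nonempty (FiniteSVD (SchattenClass.inclₗ (f x))))
    (hhD : ∀ x, Nonempty (FiniteSVD (SchattenClass.inclₗ (h x))))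
    (hf : Integrable f) (hh : MemLp h (ENNReal.ofReal q)) {G : V → SchattenClass H p}
    (hG : MemLp G (ENNReal.ofReal q)) (hhG : ∀ x, h x ≠ 0 → G x = 𝓕 (f : V → _) x) :
    (∫ x, ‖h x‖ ^ q) ^ (1 / q) ≤ (∫ x, ‖f x‖ ^ p) ^ (1 / p) + (∫ x, ‖h x - G x‖ ^ q) ^ (1 / q) := by
  have hp0 : 0 < p := hpq.pos
  have hq0 : 0 < q := hpq.symm.pos
  have hq1 : 1 ≤ ENNReal.ofReal q := by
    rw [ENNReal.one_le_ofReal]; exact hpq.symm.lt.le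
  have hq00 : ENNReal.ofReal q ≠ 0 := (zero_lt_one.trans_le hq1).ne'
  let A : f.nonzeroRange → Set V := fun i => f ⁻¹' {(i : SchattenClass H p)}
  let B : h.nonzeroRange → Set V := fun l => h ⁻¹' {(l : SchattenClass H p)}
  have hA : ∀ i, MeasurableSet (A i) := fun i => f.measurableSet_preimage _
  have hB : ∀ l, MeasurableSet (B l) := fun l => h.measurableSet_preimage _
  have hA' : ∀ i, volume (A i) ≠ ∞ := fun i =>
    (f.measure_preimage_lt_top_of_integrable hf (f.ne_zero_of_mem_nonzeroRange i)).ne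
  have hB' : ∀ l, volume (B l) ≠ ∞ := fun l =>
    (h.measure_preimage_lt_top_of_memLp hq00 ENNReal.ofReal_ne_top hh _
      (h.ne_zero_of_mem_nonzeroRange l)).ne
  have hAd : Pairwise (Function.onFun Disjoint A) := f.pairwise_disjoint_preimage
  have hBd : Pairwise (Function.onFun Disjoint B) := h.pairwise_disjoint_preimage
  have D : ∀ i : f.nonzeroRange, FiniteSVD (SchattenClass.inclₗ (i : SchattenClass H p)) :=
    fun i => Classical.choice (by
      obtain ⟨x, hx⟩ := f.exists_eq_of_mem_nonzeroRange i
      rw [← hx]; exact hfD x)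
  have E : ∀ l : h.nonzeroRange, FiniteSVD (SchattenClass.inclₗ (l : SchattenClass H p)) :=
    fun l => Classical.choice (by
      obtain ⟨x, hx⟩ := h.exists_eq_of_mem_nonzeroRange l
      rw [← hx]; exact hhD x)
  have hon : ∀ {Y : V → SchattenClass H p}, MemLp Y (ENNReal.ofReal q) →
      ∀ l, IntegrableOn Y (B l) := fun {Y} hY l => by
    have : IsFiniteMeasure (volume.restrict (B l)) := ⟨by
      rw [Measure.restrict_apply_univ]; exact (hB' l).lt_top⟩
    exact (hY.mono_measure Measure.restrict_le_self).integrable hq1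
  have hintf : ∑ i, volume.real (A i) * ‖(i : SchattenClass H p)‖ ^ p = ∫ x, ‖f x‖ ^ p :=
    (SimpleFunc.integral_comp_eq_sum hA' (g := fun T => ‖T‖ ^ p)
      (by simp [Real.zero_rpow hp0.ne'])).symm
  have hinth : ∑ l, volume.real (B l) * ‖(l : SchattenClass H p)‖ ^ q = ∫ x, ‖h x‖ ^ q :=
    (SimpleFunc.integral_comp_eq_sum hB' (g := fun T => ‖T‖ ^ q)
      (by simp [Real.zero_rpow hq0.ne'])).symm
  -- The functional `Y ↦ ∑ₗ dual (∫_{B l} Y)` norms `h`. Its value at `G` is bounded by the dual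
  -- inequality, and its value at `h - G` by Hölder's inequality.
  have hPh : ∑ l, (E l).dual q (∫ x in B l, h x) = ((∫ x, ‖h x‖ ^ q : ℝ) : ℂ) := by
    rw [← hinth]
    push_cast
    refine Finset.sum_congr rfl fun l _ => ?_
    have e : ∫ x in B l, h x = ∫ x in B l, (l : SchattenClass H p) :=
      setIntegral_congr_fun (hB l) fun x hx => hx
    rw [e, setIntegral_const, ← Complex.coe_smul, map_smul, (E l).dual_apply_self hpq]
    simp
  have hPG : ‖∑ l, (E l).dual q (∫ x in B l, G x)‖
      ≤ (∫ x, ‖f x‖ ^ p) ^ (1 / p) * (∫ x, ‖h x‖ ^ q) ^ (1 / p) := by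
    rw [← hintf, ← hinth]
    refine le_trans (le_of_eq ?_)
      (norm_sum_dual_fourierPairing_le hpq hp₂ hA hA' hAd hB hB' hBd D E)
    congr 1
    refine Finset.sum_congr rfl fun l _ => ?_
    congr 1
    have e : ∫ x in B l, G x = ∫ x in B l, ∑ i : f.nonzeroRange,
        fourierIndicator (A i) x • (i : SchattenClass H p) := by
      refine setIntegral_congr_fun (hB l) fun x hx => ?_
      rw [← SimpleFunc.fourier_eq_sum hA' x]
      refine hhG x fun h0 => h.ne_zero_of_mem_nonzeroRange l ?_
      exact (Set.mem_singleton_iff.1 hx).symm.trans h0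
    have hint : ∀ i, IntegrableOn (fourierIndicator (A i)) (B l) := fun i =>
      IntegrableOn.of_bound (hB' l).lt_top
        (continuous_fourierIndicator (hA i) (hA' i)).aestronglyMeasurable (volume.real (A i))
        (.of_forall fun ξ => norm_fourierIndicator_le (hA i) ξ)
    rw [e, integral_finsetSum _ fun i _ => (hint i).smul_const _]
    refine Finset.sum_congr rfl fun i _ => ?_
    rw [integral_smul_const, fourierPairing]
  -- The power `‖h‖ ^ (q - 1)` is in `L^p` because `q / (q - 1) = p`.
  have hhp : MemLp (fun x => ‖h x‖ ^ (q - 1)) (ENNReal.ofReal p) := by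
    have e := hh.norm_rpow_div (ENNReal.ofReal (q - 1))
    rw [ENNReal.toReal_ofReal hpq.symm.sub_one_pos.le,
      ← ENNReal.ofReal_div_of_pos hpq.symm.sub_one_pos] at e
    rwa [← hpq.symm.conjugate_eq] at e
  have hhG' : MemLp (fun x => ‖h x - G x‖) (ENNReal.ofReal q) := (hh.sub hG).norm
  have hholder : ∫ x, ‖h x‖ ^ (q - 1) * ‖h x - G x‖
      ≤ (∫ x, ‖h x‖ ^ q) ^ (1 / p) * (∫ x, ‖h x - G x‖ ^ q) ^ (1 / q) := by
    have e := integral_mul_norm_le_Lp_mul_Lq hpq hhp hhG'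
    have e2 : ∀ x, (‖h x‖ ^ (q - 1)) ^ p = ‖h x‖ ^ q := fun x => by
      rw [← Real.rpow_mul (norm_nonneg _), hpq.symm.sub_one_mul_conj]
    have e3 : ∀ x, ‖‖h x‖ ^ (q - 1)‖ = ‖h x‖ ^ (q - 1) := fun x =>
      Real.norm_of_nonneg (Real.rpow_nonneg (norm_nonneg _) _)
    simpa only [norm_norm, e3, e2] using e
  have hprod : Integrable fun x => ‖h x‖ ^ (q - 1) * ‖h x - G x‖ := by
    have : (ENNReal.ofReal p).HolderConjugate (ENNReal.ofReal q) := hpq.ennrealOfReal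
    exact hhp.integrable_mul hhG'
  have hPsub : ‖∑ l, (E l).dual q (∫ x in B l, (h x - G x))‖
      ≤ ∫ x, ‖h x‖ ^ (q - 1) * ‖h x - G x‖ := by
    calc _ ≤ ∑ l : h.nonzeroRange, ∫ x in B l, ‖h x‖ ^ (q - 1) * ‖h x - G x‖ := by
          refine (norm_sum_le _ _).trans (Finset.sum_le_sum fun l _ => ?_)
          refine ((E l).norm_dual_apply_le hpq _).trans ?_
          have e : ∫ x in B l, ‖h x‖ ^ (q - 1) * ‖h x - G x‖
              = ∫ x in B l, ‖(l : SchattenClass H p)‖ ^ (q - 1) * ‖h x - G x‖ :=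
            setIntegral_congr_fun (hB l) fun x hx => by
              have hx' : h x = l := hx
              simp only [hx']
          rw [e, integral_const_mul]
          exact mul_le_mul_of_nonneg_left (norm_integral_le_integral_norm _)
            (Real.rpow_nonneg (norm_nonneg _) _)
      _ = ∫ x in ⋃ l, B l, ‖h x‖ ^ (q - 1) * ‖h x - G x‖ :=
          (integral_iUnion_fintype hB hBd fun l => hprod.integrableOn).symm
      _ ≤ _ := setIntegral_le_integral hprod (.of_forall fun x =>
          mul_nonneg (Real.rpow_nonneg (norm_nonneg _) _) (norm_nonneg _))
  refine le_add_of_le_mul_rpow_add hpq (integral_nonneg fun x => Real.rpow_nonneg (norm_nonneg _) _)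
    (Real.rpow_nonneg (integral_nonneg fun x => Real.rpow_nonneg (norm_nonneg _) _) _)
    (Real.rpow_nonneg (integral_nonneg fun x => Real.rpow_nonneg (norm_nonneg _) _) _) ?_
  have hsplit : ((∫ x, ‖h x‖ ^ q : ℝ) : ℂ) = ∑ l, (E l).dual q (∫ x in B l, G x)
      + ∑ l, (E l).dual q (∫ x in B l, (h x - G x)) := by
    rw [← hPh, ← Finset.sum_add_distrib]
    refine Finset.sum_congr rfl fun l _ => ?_
    rw [integral_sub (hon hh l) (hon hG l), map_sub, add_sub_cancel]
  calc ∫ x, ‖h x‖ ^ q = ‖((∫ x, ‖h x‖ ^ q : ℝ) : ℂ)‖ := by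
        rw [Complex.norm_real, Real.norm_of_nonneg
          (integral_nonneg fun x => Real.rpow_nonneg (norm_nonneg _) _)]
    _ ≤ _ := by
        rw [hsplit]
        exact (norm_add_le _ _).trans (add_le_add hPG (hPsub.trans hholder))

end HausdorffYoung

/-! ### From step functions to integrable functions -/

section HausdorffYoung

variable {V : Type*} [NormedAddCommGroup V] [InnerProductSpace ℝ V] [FiniteDimensional ℝ V]
  [MeasurableSpace V] [BorelSpace V]

lemma norm_fourier_sub_le {X : Type*} [NormedAddCommGroup X] [NormedSpace ℂ X] {f g : V → X}
    (hf : Integrable f) (hg : Integrable g) (ξ : V) :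
    ‖𝓕 f ξ - 𝓕 g ξ‖ ≤ (eLpNorm (f - g) 1 volume).toReal := by
  have h : 𝓕 f ξ - 𝓕 g ξ = 𝓕 (f - g) ξ := by
    rw [Real.fourier_eq, Real.fourier_eq, Real.fourier_eq, ← integral_sub
      ((Real.fourierIntegral_convergent_iff ξ).2 hf) ((Real.fourierIntegral_convergent_iff ξ).2 hg)]
    simp only [Pi.sub_apply, smul_sub]
  rw [h, eLpNorm_one_eq_lintegral_enorm, ← integral_norm_eq_lintegral_enorm (hf.sub hg).1]
  exact norm_fourier_le_integral_norm _ ξ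

variable {H : Type*} [NormedAddCommGroup H] [InnerProductSpace ℂ H] [CompleteSpace H]
  {p : ℝ} [hp : Fact (1 ≤ p)]

/-- On a set of finite measure the bounded transform is in `L^q` a priori, hence a limit of finite
rank simple functions, to which the duality step applies with an error tending to zero. -/
lemma eLpNorm_indicator_fourier_le_of_finiteSVD {q : ℝ} (hpq : p.HolderConjugate q) (hp₂ : p ≤ 2)
    {f : SimpleFunc V (SchattenClass H p)}
    (hfD : ∀ x, Nonempty (FiniteSVD (SchattenClass.inclₗ (f x)))) (hf : Integrable f)
    {K : Set V} (hK : MeasurableSet K) (hK' : volume K ≠ ∞) :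
    eLpNorm (K.indicator (𝓕 (f : V → SchattenClass H p))) (ENNReal.ofReal q) volume
      ≤ eLpNorm f (ENNReal.ofReal p) volume := by
  have hp0 : 0 < p := hpq.pos
  have hq0 : 0 < q := hpq.symm.pos
  have hp00 : ENNReal.ofReal p ≠ 0 := (ENNReal.ofReal_pos.2 hp0).ne'
  have hq00 : ENNReal.ofReal q ≠ 0 := (ENNReal.ofReal_pos.2 hq0).ne'
  have hq1 : 1 ≤ ENNReal.ofReal q := by
    rw [ENNReal.one_le_ofReal]; exact hpq.symm.lt.le
  set G := K.indicator (𝓕 (f : V → SchattenClass H p)) with hGdef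
  have hcont := continuous_fourier_of_integrable hf
  have hGm : StronglyMeasurable G := hcont.stronglyMeasurable.indicator hK
  have hG : MemLp G (ENNReal.ofReal q) volume := by
    have : IsFiniteMeasure (volume.restrict K) := ⟨by
      rw [Measure.restrict_apply_univ]; exact hK'.lt_top⟩
    rw [hGdef, memLp_indicator_iff_restrict hK]
    exact MemLp.of_bound hcont.aestronglyMeasurable _
      (.of_forall fun ξ => norm_fourier_le_integral_norm _ ξ)
  have hfp : MemLp f (ENNReal.ofReal p) volume :=
    (SimpleFunc.memLp_iff_integrable hp00 ENNReal.ofReal_ne_top).2 hf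
  obtain ⟨h, hD, hr⟩ := exists_simpleFunc_finiteSVD_tendsto (μ := volume) hGm
  obtain ⟨hmem, htend⟩ := hr _ ENNReal.ofReal_ne_top hq1 hG
  have key : ∀ m, eLpNorm G (ENNReal.ofReal q) volume
      ≤ eLpNorm f (ENNReal.ofReal p) volume
        + 2 * eLpNorm (⇑(h m) - G) (ENNReal.ofReal q) volume := by
    intro m
    -- The approximant is cut off to `K` because `G` agrees with the Fourier transform only there.
    let k := (h m).restrict K
    have hk : ⇑k = K.indicator (h m) := (h m).coe_restrict hK
    have hkD : ∀ x, Nonempty (FiniteSVD (SchattenClass.inclₗ (k x))) := fun x => by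
      rw [hk]
      by_cases hx : x ∈ K
      · rw [Set.indicator_of_mem hx]; exact hD m x
      · rw [Set.indicator_of_notMem hx, map_zero]; exact ⟨FiniteSVD.zero⟩
    have hkm : MemLp k (ENNReal.ofReal q) volume := by rw [hk]; exact (hmem m).indicator hK
    have hkG : ∀ x, k x ≠ 0 → G x = 𝓕 (f : V → _) x := fun x hx => by
      have hxK : x ∈ K := by
        by_contra hx'
        exact hx (by rw [hk, Set.indicator_of_notMem hx'])
      rw [hGdef, Set.indicator_of_mem hxK]
    have hsub : eLpNorm (⇑k - G) (ENNReal.ofReal q) volume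
        ≤ eLpNorm (⇑(h m) - G) (ENNReal.ofReal q) volume := by
      have e : ⇑k - G = K.indicator (⇑(h m) - G) := by
        rw [hk, hGdef, Set.indicator_sub', Set.indicator_indicator, Set.inter_self]
      rw [e]
      exact eLpNorm_indicator_le _
    have hmain := integral_rpow_le_of_finiteSVD hpq hp₂ hfD hkD hf hkm hG hkG
    have hmain' : eLpNorm k (ENNReal.ofReal q) volume ≤ eLpNorm f (ENNReal.ofReal p) volume
        + eLpNorm (⇑k - G) (ENNReal.ofReal q) volume := by
      rw [hkm.eLpNorm_eq_integral_rpow_norm hq00 ENNReal.ofReal_ne_top,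
        hfp.eLpNorm_eq_integral_rpow_norm hp00 ENNReal.ofReal_ne_top,
        (hkm.sub hG).eLpNorm_eq_integral_rpow_norm hq00 ENNReal.ofReal_ne_top,
        ← ENNReal.ofReal_add (by positivity) (by positivity),
        ENNReal.toReal_ofReal hp0.le, ENNReal.toReal_ofReal hq0.le]
      simp only [one_div] at hmain
      exact ENNReal.ofReal_le_ofReal hmain
    calc eLpNorm G (ENNReal.ofReal q) volume
        = eLpNorm (⇑k - (⇑k - G)) (ENNReal.ofReal q) volume := by rw [sub_sub_cancel]
      _ ≤ eLpNorm k (ENNReal.ofReal q) volume + eLpNorm (⇑k - G) (ENNReal.ofReal q) volume :=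
          eLpNorm_sub_le hkm.1 (hkm.sub hG).1 hq1
      _ ≤ eLpNorm f (ENNReal.ofReal p) volume + eLpNorm (⇑k - G) (ENNReal.ofReal q) volume
          + eLpNorm (⇑k - G) (ENNReal.ofReal q) volume := by gcongr
      _ = eLpNorm f (ENNReal.ofReal p) volume
          + 2 * eLpNorm (⇑k - G) (ENNReal.ofReal q) volume := by rw [two_mul, add_assoc]
      _ ≤ _ := by gcongr
  have hlim : Tendsto (fun m => eLpNorm f (ENNReal.ofReal p) volume
      + 2 * eLpNorm (⇑(h m) - G) (ENNReal.ofReal q) volume) atTop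
      (𝓝 (eLpNorm f (ENNReal.ofReal p) volume + 2 * 0)) :=
    tendsto_const_nhds.add (ENNReal.Tendsto.const_mul htend (Or.inr (by simp)))
  rw [mul_zero, add_zero] at hlim
  exact ge_of_tendsto' hlim key

/-- Balls exhaust the space, and Fatou's lemma removes the cutoff without assuming that the
transform is in `L^q`. -/
lemma eLpNorm_fourier_le_of_finiteSVD {q : ℝ} (hpq : p.HolderConjugate q) (hp₂ : p ≤ 2)
    {f : SimpleFunc V (SchattenClass H p)}
    (hfD : ∀ x, Nonempty (FiniteSVD (SchattenClass.inclₗ (f x)))) (hf : Integrable f) :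
    eLpNorm (𝓕 (f : V → SchattenClass H p)) (ENNReal.ofReal q) volume
      ≤ eLpNorm f (ENNReal.ofReal p) volume := by
  let G : ℕ → V → SchattenClass H p := fun m =>
    (Metric.ball (0 : V) m).indicator (𝓕 (f : V → SchattenClass H p))
  have hm : ∀ m, AEStronglyMeasurable (G m) volume := fun m =>
    ((continuous_fourier_of_integrable hf).stronglyMeasurable.indicator
      measurableSet_ball).aestronglyMeasurable
  have hlim : ∀ x, Tendsto (fun m => G m x) atTop (𝓝 (𝓕 (f : V → SchattenClass H p) x)) := by
    intro x
    refine tendsto_const_nhds.congr' ?_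
    obtain ⟨N, hN⟩ := exists_nat_gt ‖x‖
    filter_upwards [eventually_ge_atTop N] with m hNm
    have hx : x ∈ Metric.ball (0 : V) m := by
      rw [mem_ball_zero_iff]
      exact hN.trans_le (by exact_mod_cast hNm)
    simp only [G]
    rw [Set.indicator_of_mem hx]
  refine (Lp.eLpNorm_lim_le_liminf_eLpNorm hm _ (.of_forall hlim)).trans ?_
  refine (liminf_le_liminf (v := fun _ => eLpNorm f (ENNReal.ofReal p) volume)
    (.of_forall fun m => ?_)).trans (le_of_eq (by simp))
  exact eLpNorm_indicator_fourier_le_of_finiteSVD hpq hp₂ hfD hf measurableSet_ball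
    measure_ball_lt_top.ne

/-- The **Hausdorff-Young inequality** for functions with values in the Schatten class. -/
theorem SchattenClass.eLpNorm_fourier_le {q : ℝ} (hpq : p.HolderConjugate q) (hp₂ : p ≤ 2)
    {f : V → SchattenClass H p} (hf : Integrable f) (hfp : MemLp f (ENNReal.ofReal p)) :
    eLpNorm (𝓕 f) (ENNReal.ofReal q) volume ≤ eLpNorm f (ENNReal.ofReal p) volume := by
  have hp1 : 1 ≤ ENNReal.ofReal p := by
    rw [ENNReal.one_le_ofReal]; exact hpq.lt.le
  set g := hf.1.mk f with hg
  have hfg : f =ᵐ[volume] g := hf.1.ae_eq_mk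
  have hgi : Integrable g := hf.congr hfg
  have hgp : MemLp g (ENNReal.ofReal p) := hfp.ae_eq hfg
  rw [eLpNorm_congr_ae hfg, show 𝓕 f = 𝓕 g from funext fun ξ => Real.fourier_congr_ae hfg ξ]
  obtain ⟨h, hD, hr⟩ := exists_simpleFunc_finiteSVD_tendsto (μ := volume)
    hf.1.stronglyMeasurable_mk
  obtain ⟨h1m, h1t⟩ := hr 1 ENNReal.one_ne_top le_rfl (memLp_one_iff_integrable.2 hgi)
  obtain ⟨hpm, hpt⟩ := hr _ ENNReal.ofReal_ne_top hp1 hgp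
  have hhi : ∀ m, Integrable (h m) := fun m => memLp_one_iff_integrable.1 (h1m m)
  -- Convergence in `L¹` gives pointwise convergence of the transforms; convergence in `L^p` then
  -- controls their norms for Fatou's lemma.
  have hlim : ∀ ξ, Tendsto (fun m => 𝓕 (h m : V → SchattenClass H p) ξ) atTop (𝓝 (𝓕 g ξ)) := by
    intro ξ
    rw [tendsto_iff_norm_sub_tendsto_zero]
    have h0 : Tendsto (fun m => (eLpNorm (⇑(h m) - g) 1 volume).toReal) atTop (𝓝 0) := by
      have h2 := (ENNReal.tendsto_toReal ENNReal.zero_ne_top).comp h1t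
      rwa [ENNReal.toReal_zero] at h2
    exact squeeze_zero (fun _ => norm_nonneg _) (fun m => norm_fourier_sub_le (hhi m) hgi ξ) h0
  have hmeas : ∀ m, AEStronglyMeasurable (𝓕 (h m : V → SchattenClass H p)) volume := fun m =>
    (continuous_fourier_of_integrable (hhi m)).aestronglyMeasurable
  refine (Lp.eLpNorm_lim_le_liminf_eLpNorm hmeas _ (.of_forall hlim)).trans ?_
  have hb : ∀ m, eLpNorm (𝓕 (h m : V → SchattenClass H p)) (ENNReal.ofReal q) volume
      ≤ eLpNorm (⇑(h m) - g) (ENNReal.ofReal p) volume + eLpNorm g (ENNReal.ofReal p) volume :=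
    fun m => by
      refine (eLpNorm_fourier_le_of_finiteSVD hpq hp₂ (hD m) (hhi m)).trans ?_
      conv_lhs => rw [← sub_add_cancel (⇑(h m)) g]
      exact eLpNorm_add_le ((hpm m).sub hgp).1 hgp.1 hp1
  refine (liminf_le_liminf (.of_forall hb)).trans (le_of_eq ?_)
  have ht := hpt.add (tendsto_const_nhds (x := eLpNorm g (ENNReal.ofReal p) volume))
  rw [zero_add] at ht
  exact ht.liminf_eq

end HausdorffYoung

/-! ### Passage between operator valued and `SchattenClass` valued functions -/

section Lift

variable {H : Type*} [NormedAddCommGroup H] [InnerProductSpace ℂ H] [CompleteSpace H]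
  {p : ℝ} [hp : Fact (1 ≤ p)]

open Classical in
/-- An operator as an element of the Schatten class, with the value `0` outside of the class. -/
def SchattenClass.lift (A : H →L[ℂ] H) : SchattenClass H p :=
  if h : A ∈ schattenSubmodule H p then SchattenClass.mk A h.1 h.2 else 0

lemma SchattenClass.inclₗ_lift {A : H →L[ℂ] H} (hA : MemSchatten p A) :
    SchattenClass.inclₗ (SchattenClass.lift A : SchattenClass H p) = A := by
  rw [SchattenClass.lift, dif_pos ((memSchatten_iff_mem_schattenSubmodule p).1 hA),
    SchattenClass.inclₗ_mk]

lemma SchattenClass.memSchatten (T : SchattenClass H p) : MemSchatten p (SchattenClass.inclₗ T) :=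
  (memSchatten_iff_mem_schattenSubmodule p).2 T.2

lemma SchattenClass.enorm_sub_eq_schattenNorm (S T : SchattenClass H p) :
    ‖S - T‖ₑ = schattenNorm p (SchattenClass.inclₗ S - SchattenClass.inclₗ T) := by
  rw [SchattenClass.enorm_eq_schattenNorm, map_sub]

variable {Ω : Type*} [MeasurableSpace Ω] {μ : Measure Ω}

lemma SchattenAEStronglyMeasurable.aestronglyMeasurable_lift {f : Ω → H →L[ℂ] H}
    (hf : SchattenAEStronglyMeasurable p f μ) (hf' : ∀ᵐ x ∂μ, MemSchatten p (f x)) :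
    AEStronglyMeasurable (fun x => (SchattenClass.lift (f x) : SchattenClass H p)) μ := by
  obtain ⟨F, hF, hlim⟩ := hf
  refine aestronglyMeasurable_of_tendsto_ae atTop
    (f := fun k x => ((F k).map SchattenClass.lift x : SchattenClass H p))
    (fun k => ((F k).map SchattenClass.lift).aestronglyMeasurable) ?_
  filter_upwards [hlim, hf'] with x hx hx'
  rw [tendsto_iff_enorm_sub_tendsto_zero]
  refine hx.congr fun k => ?_
  rw [SchattenClass.enorm_sub_eq_schattenNorm, SimpleFunc.map_apply,
    SchattenClass.inclₗ_lift (hF k x), SchattenClass.inclₗ_lift hx']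

lemma schattenAEStronglyMeasurable_inclₗ {g : Ω → SchattenClass H p}
    (hg : StronglyMeasurable g) :
    SchattenAEStronglyMeasurable p (fun x => SchattenClass.inclₗ (g x)) μ := by
  refine ⟨fun k => (hg.approx k).map SchattenClass.inclₗ, fun k x => ?_, .of_forall fun x => ?_⟩
  · exact SchattenClass.memSchatten _
  · have h := tendsto_iff_enorm_sub_tendsto_zero.1 (hg.tendsto_approx x)
    simpa only [SchattenClass.enorm_sub_eq_schattenNorm, SimpleFunc.map_apply] using h

lemma eLpNorm_lift {f : Ω → H →L[ℂ] H} (hf : ∀ᵐ x ∂μ, MemSchatten p (f x)) (r : ℝ≥0∞) :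
    eLpNorm (fun x => (SchattenClass.lift (f x) : SchattenClass H p)) r μ
      = eLpNorm (fun x => schattenNorm p (f x)) r μ := by
  refine eLpNorm_congr_enorm_ae ?_
  filter_upwards [hf] with x hx
  rw [SchattenClass.enorm_eq_schattenNorm, SchattenClass.inclₗ_lift hx, enorm_eq_self]

lemma MemSchattenLp.memLp_lift {f : Ω → H →L[ℂ] H} {r : ℝ≥0∞} (hf : MemSchattenLp p r f μ) :
    MemLp (fun x => (SchattenClass.lift (f x) : SchattenClass H p)) r μ :=
  ⟨hf.2.1.aestronglyMeasurable_lift hf.1, (eLpNorm_lift hf.1 r).trans_lt hf.2.2⟩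

end Lift

/-! ### Dilations and intermediate exponents -/

section Scaling

variable {V : Type*} [NormedAddCommGroup V] [InnerProductSpace ℝ V] [FiniteDimensional ℝ V]
  [MeasurableSpace V] [BorelSpace V]

lemma lintegral_comp_smul {r : ℝ} (hr : r ≠ 0) {φ : V → ℝ≥0∞} (hφ : Measurable φ) :
    ∫⁻ x, φ (r • x) = ENNReal.ofReal |(r ^ Module.finrank ℝ V)⁻¹| * ∫⁻ x, φ x := by
  rw [← lintegral_map hφ (measurable_const_smul r), Measure.map_addHaar_smul volume hr,
    lintegral_smul_measure, smul_eq_mul]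

/-- Pointwise, `t ^ p ≤ t + t ^ 2` for `1 ≤ p ≤ 2`. -/
lemma MeasureTheory.MemLp.of_one_of_two {X : Type*} [NormedAddCommGroup X] {f : V → X} {p : ℝ}
    (hp₁ : 1 ≤ p) (hp₂ : p ≤ 2) (h₁ : MemLp f 1) (h₂ : MemLp f 2) :
    MemLp f (ENNReal.ofReal p) := by
  have hp0 : 0 < p := by linarith
  refine ⟨h₁.1, ?_⟩
  rw [eLpNorm_lt_top_iff_lintegral_rpow_enorm_lt_top (ENNReal.ofReal_pos.2 hp0).ne'
    ENNReal.ofReal_ne_top, ENNReal.toReal_ofReal hp0.le]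
  have h1 := lintegral_rpow_enorm_lt_top_of_eLpNorm_lt_top one_ne_zero ENNReal.one_ne_top h₁.2
  have h2 := lintegral_rpow_enorm_lt_top_of_eLpNorm_lt_top two_ne_zero ENNReal.ofNat_ne_top h₂.2
  calc ∫⁻ x, ‖f x‖ₑ ^ p
      ≤ ∫⁻ x, (‖f x‖ₑ ^ (1 : ℝ≥0∞).toReal + ‖f x‖ₑ ^ (2 : ℝ≥0∞).toReal) := by
        refine lintegral_mono fun x => ?_
        simp only [ENNReal.toReal_one, ENNReal.toReal_ofNat]
        rcases le_total ‖f x‖ₑ 1 with h | h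
        · exact (ENNReal.rpow_le_rpow_of_exponent_ge h hp₁).trans le_self_add
        · exact (ENNReal.rpow_le_rpow_of_exponent_le h hp₂).trans le_add_self
    _ = _ := lintegral_add_left' (h₁.1.enorm.pow_const _) _
    _ < ∞ := ENNReal.add_lt_top.2 ⟨h1, h2⟩

end Scaling

/-! ### The transform with kernel `e^{-i ξ · θ}` -/

section OperatorFourier

variable {H : Type*} [NormedAddCommGroup H] [InnerProductSpace ℂ H] [CompleteSpace H]
  {p : ℝ} [hp : Fact (1 ≤ p)] {n : ℕ}

/-- The transform `𝓕` has the kernel `e^{-2πi ξ · θ}`, so the frequency is divided by `2π`. -/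
lemma fourierIntegrand_ae_eq {A : EuclideanSpace ℝ (Fin n) → H →L[ℂ] H}
    (hA : ∀ᵐ θ, MemSchatten p (A θ)) (ξ : EuclideanSpace ℝ (Fin n)) :
    fourierIntegrand A ξ =ᵐ[volume] fun θ => SchattenClass.incl
      (Real.fourierChar (-⟪θ, (2 * Real.pi)⁻¹ • ξ⟫_ℝ) •
        (SchattenClass.lift (A θ) : SchattenClass H p)) := by
  filter_upwards [hA] with θ hθ
  rw [Circle.smul_def, map_smul, SchattenClass.incl_apply, SchattenClass.inclₗ_lift hθ,
    fourierIntegrand, Real.fourierChar_apply]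
  congr 2
  rw [inner_smul_right, real_inner_comm]
  have : (Real.pi : ℂ) ≠ 0 := by exact_mod_cast Real.pi_ne_zero
  push_cast
  field_simp

lemma integrable_fourierIntegrand {A : EuclideanSpace ℝ (Fin n) → H →L[ℂ] H}
    (hA : MemSchattenLp p 1 A volume) (ξ : EuclideanSpace ℝ (Fin n)) :
    Integrable (fourierIntegrand A ξ) volume := by
  rw [integrable_congr (fourierIntegrand_ae_eq hA.1 ξ)]
  refine ContinuousLinearMap.integrable_comp (SchattenClass.incl (H := H) (p := p)) ?_
  exact (Real.fourierIntegral_convergent_iff _).2 (memLp_one_iff_integrable.1 hA.memLp_lift)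

/-- The Hausdorff-Young inequality for the Fourier transform with the kernel `e^{-i ξ · θ}`. -/
lemma SchattenClass.lintegral_enorm_fourier_rpow_le {q : ℝ} (hpq : p.HolderConjugate q)
    (hp₂ : p ≤ 2) {f : EuclideanSpace ℝ (Fin n) → SchattenClass H p} (hf : Integrable f)
    (hfp : MemLp f (ENNReal.ofReal p)) :
    ENNReal.ofReal (1 / (2 * Real.pi) ^ n) * ∫⁻ ξ, ‖𝓕 f ((2 * Real.pi)⁻¹ • ξ)‖ₑ ^ q
      ≤ (∫⁻ θ, ‖f θ‖ₑ ^ p) ^ (q / p) := by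
  have hp0 : 0 < p := hpq.pos
  have hq0 : 0 < q := hpq.symm.pos
  have hπ : 0 < 2 * Real.pi := by positivity
  have hm : Measurable fun η => ‖𝓕 f η‖ₑ ^ q :=
    ((continuous_fourier_of_integrable hf).enorm.measurable).pow_const q
  have h := SchattenClass.eLpNorm_fourier_le hpq hp₂ hf hfp
  rw [eLpNorm_eq_lintegral_rpow_enorm_toReal (ENNReal.ofReal_pos.2 hq0).ne' ENNReal.ofReal_ne_top,
    eLpNorm_eq_lintegral_rpow_enorm_toReal (ENNReal.ofReal_pos.2 hp0).ne' ENNReal.ofReal_ne_top,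
    ENNReal.toReal_ofReal hp0.le, ENNReal.toReal_ofReal hq0.le] at h
  -- The dilation contributes `(2π)ⁿ`, which cancels the normalising constant.
  rw [lintegral_comp_smul (inv_ne_zero hπ.ne') hm, finrank_euclideanSpace_fin, ← mul_assoc,
    ← ENNReal.ofReal_mul (by positivity), inv_pow, inv_inv, abs_of_pos (by positivity),
    one_div_mul_cancel (by positivity), ENNReal.ofReal_one, one_mul]
  calc _ = ((∫⁻ η, ‖𝓕 f η‖ₑ ^ q) ^ (1 / q)) ^ q := by
        rw [one_div, ENNReal.rpow_inv_rpow hq0.ne']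
    _ ≤ ((∫⁻ θ, ‖f θ‖ₑ ^ p) ^ (1 / p)) ^ q := by gcongr
    _ = _ := by rw [← ENNReal.rpow_mul]; congr 1; ring

variable (p) in
/-- The Fourier transform of an operator valued function, with values in the Schatten class. -/
def schattenFourier (A : EuclideanSpace ℝ (Fin n) → H →L[ℂ] H) (ξ : EuclideanSpace ℝ (Fin n)) :
    SchattenClass H p :=
  𝓕 (fun θ => (SchattenClass.lift (A θ) : SchattenClass H p)) ((2 * Real.pi)⁻¹ • ξ)

variable {A : EuclideanSpace ℝ (Fin n) → H →L[ℂ] H}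

/-- The continuous inclusion of `S_p` commutes with the Bochner integral, so the integral taken in
`B(H)` is the one taken in `S_p`. -/
lemma inclₗ_schattenFourier (hA : MemSchattenLp p 1 A volume) (ξ : EuclideanSpace ℝ (Fin n)) :
    SchattenClass.inclₗ (schattenFourier p A ξ) = operatorFourier A ξ := by
  rw [operatorFourier, integral_congr_ae (fourierIntegrand_ae_eq hA.1 ξ),
    ContinuousLinearMap.integral_comp_comm]
  · rfl
  · exact (Real.fourierIntegral_convergent_iff _).2 (memLp_one_iff_integrable.1 hA.memLp_lift)

lemma continuous_schattenFourier (hA : MemSchattenLp p 1 A volume) :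
    Continuous (schattenFourier p A) :=
  (continuous_fourier_of_integrable (memLp_one_iff_integrable.1 hA.memLp_lift)).comp
    (continuous_const_smul _)

lemma lintegral_enorm_lift_rpow (hA : ∀ᵐ θ, MemSchatten p (A θ)) (r : ℝ) :
    ∫⁻ θ, ‖(SchattenClass.lift (A θ) : SchattenClass H p)‖ₑ ^ r
      = ∫⁻ θ, schattenNorm p (A θ) ^ r := by
  refine lintegral_congr_ae ?_
  filter_upwards [hA] with θ hθ
  rw [SchattenClass.enorm_eq_schattenNorm, SchattenClass.inclₗ_lift hθ]

lemma enorm_schattenFourier_le (hA : MemSchattenLp p 1 A volume) (ξ : EuclideanSpace ℝ (Fin n)) :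
    ‖schattenFourier p A ξ‖ₑ ≤ ∫⁻ θ, schattenNorm p (A θ) := by
  have h := lintegral_enorm_lift_rpow hA.1 1
  simp only [ENNReal.rpow_one] at h
  rw [← h, ← ofReal_integral_norm_eq_lintegral_enorm
    (memLp_one_iff_integrable.1 hA.memLp_lift), ← ofReal_norm]
  exact ENNReal.ofReal_le_ofReal (norm_fourier_le_integral_norm _ _)

end OperatorFourier

end

/-! ### The theorem -/

theorem mainTheorem5 {H : Type*} [NormedAddCommGroup H] [InnerProductSpace ℂ H] [CompleteSpace H]
    [TopologicalSpace.SeparableSpace H] (n : ℕ)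
    (p : ℝ) (hp₁ : 1 ≤ p) (hp₂ : p ≤ 2)
    (q : ℝ≥0∞) (hq : (ENNReal.ofReal p).HolderConjugate q)
    (A : EuclideanSpace ℝ (Fin n) → H →L[ℂ] H)
    (hA₁ : MemSchattenLp p 1 A volume) (hA₂ : MemSchattenLp p 2 A volume) :
    (∀ ξ, Integrable (fourierIntegrand A ξ) volume ∧ MemSchatten p (operatorFourier A ξ)) ∧
    MemSchattenLp p q (operatorFourier A) volume ∧
    (1 < p →
      ENNReal.ofReal (1 / (2 * Real.pi) ^ n) *
          ∫⁻ ξ, schattenNorm p (operatorFourier A ξ) ^ q.toReal ≤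
        (∫⁻ θ, schattenNorm p (A θ) ^ p) ^ (q.toReal / p)) ∧
    (p = 1 →
      (⨆ ξ, schattenNorm 1 (operatorFourier A ξ)) ≤ ∫⁻ θ, schattenNorm 1 (A θ)) := by
  have hp : Fact (1 ≤ p) := ⟨hp₁⟩
  have hB : operatorFourier A = fun ξ => SchattenClass.inclₗ (schattenFourier p A ξ) :=
    funext fun ξ => (inclₗ_schattenFourier hA₁ ξ).symm
  have hnorm : ∀ ξ, schattenNorm p (operatorFourier A ξ) = ‖schattenFourier p A ξ‖ₑ := fun ξ => by
    rw [hB, SchattenClass.enorm_eq_schattenNorm]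
  have hfp := MemLp.of_one_of_two hp₁ hp₂ hA₁.memLp_lift hA₂.memLp_lift
  have hpq : 1 < p → p.HolderConjugate q.toReal := fun h1 => by
    have h := hq.toReal (by rwa [ENNReal.toReal_ofReal (by linarith)])
    rwa [ENNReal.toReal_ofReal (by linarith)] at h
  have hint : 1 < p → ENNReal.ofReal (1 / (2 * Real.pi) ^ n) *
      ∫⁻ ξ, schattenNorm p (operatorFourier A ξ) ^ q.toReal ≤
        (∫⁻ θ, schattenNorm p (A θ) ^ p) ^ (q.toReal / p) := fun h1 => by
    simp only [hnorm]
    rw [← lintegral_enorm_lift_rpow hA₁.1 p]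
    exact SchattenClass.lintegral_enorm_fourier_rpow_le (hpq h1) hp₂
      (memLp_one_iff_integrable.1 hA₁.memLp_lift) hfp
  refine ⟨fun ξ => ⟨integrable_fourierIntegrand hA₁ ξ, ?_⟩, ⟨.of_forall fun ξ => ?_, ?_, ?_⟩,
    hint, fun h1 => ?_⟩
  · rw [hB]; exact SchattenClass.memSchatten _
  · rw [hB]; exact SchattenClass.memSchatten _
  · rw [hB]
    exact schattenAEStronglyMeasurable_inclₗ (continuous_schattenFourier hA₁).stronglyMeasurable
  · rcases eq_or_lt_of_le hp₁ with h1 | h1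
    · have hqt : q = ∞ := by
        rw [← h1, ENNReal.ofReal_one] at hq
        simpa using (ENNReal.isConjExponent_iff_eq_conjExponent le_rfl).1 hq
      have hfin := hA₁.2.2
      rw [eLpNorm_one_eq_lintegral_enorm] at hfin
      rw [hqt, eLpNorm_exponent_top]
      refine (eLpNormEssSup_le_of_ae_enorm_bound (.of_forall fun ξ => ?_)).trans_lt hfin
      rw [enorm_eq_self, hnorm]
      exact enorm_schattenFourier_le hA₁ ξ
    · have hq0 : 0 < q.toReal := (hpq h1).symm.pos
      obtain ⟨hq00, hqt⟩ := ENNReal.toReal_pos_iff.1 hq0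
      rw [eLpNorm_lt_top_iff_lintegral_rpow_enorm_lt_top hq00.ne' hqt.ne]
      simp only [enorm_eq_self]
      have hfin : (∫⁻ θ, schattenNorm p (A θ) ^ p) ^ (q.toReal / p) < ∞ := by
        refine ENNReal.rpow_lt_top_of_nonneg (by positivity) ?_
        have h := lintegral_rpow_enorm_lt_top_of_eLpNorm_lt_top
          (ENNReal.ofReal_pos.2 (by linarith)).ne' ENNReal.ofReal_ne_top hfp.2
        rw [ENNReal.toReal_ofReal (by linarith), lintegral_enorm_lift_rpow hA₁.1 p] at h
        exact h.ne
      have h := (hint h1).trans_lt hfin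
      -- An infinite integral would stay infinite after multiplication by the positive constant,
      -- contrary to the inequality.
      refine lt_top_iff_ne_top.2 fun htop => h.ne ?_
      rw [htop]
      exact ENNReal.mul_top (ENNReal.ofReal_pos.2 (by positivity)).ne'
  · subst h1
    refine iSup_le fun ξ => ?_
    rw [hnorm]
    exact enorm_schattenFourier_le hA₁ ξ
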